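/- Let $d_A,d_B$ be natural numbers and let $V$ be a unitary operator on $\mathbb{C}^{d_A}\otimes\mathbb{C}^{d_B}$. Identify $\mathcal{U}_{d_Ad_B}$ with the unitary group of $\mathbb{C}^{d_A}\otimes\mathbb{C}^{d_B}$. A vector of $\mathbb{C}^{d_A}\otimes\mathbb{C}^{d_B}$ is called entangled if it is not of the form $a\otimes b$, and $V$ is called imprimitive if there are $a\in\mathbb{C}^{d_A}$, $b\in\mathbb{C}^{d_B}$ such that $V(a\otimes b)$ is entangled. Let $$S=\{U_A\otimes U_B : U_A\in\mathcal{U}_{d_A},\ U_B\in\mathcal{U}_{d_B}\}\cup\{V\}\subset\mathcal{U}_{d_Ad_B}.$$ (1) $V$ is imprimitive if and only if $V$ is not of the form $U_A\otimes U_B$ with $U_A\in\mathcal{U}_{d_A}$, $U_B\in\mathcal{U}_{d_B}$, nor, in case $d_A=d_B$, of the form $\mathrm{SWAP}\cdot(U_A\otimes U_B)$, where $\mathrm{SWAP}(x\otimes y)=y\otimes x$. (2) If $V$ is imprimitive, then $S$ is exactly universal for $\mathcal{U}_{d_Ad_B}$: every $W\in\mathcal{U}_{d_Ad_B}$ is a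 product $W=U_k\cdots U_2U_1$ of finitely many ($k\ge 1$) elements $U_1,\dots,U_k$ of $S$ (inverses are not used). In fact there is an integer $L\ge 0$, which may depend on $V$, such that $S^L=\mathcal{U}_{d_Ad_B}$, where $S^L$ is the set of all products of $L$ elements of $S$. -/

import Mathlib

open scoped Kronecker Pointwise

namespace BipartiteGates

/-- The unitary group of `ℂ^dA ⊗ ℂ^dB` (dimension `dA * dB`), written in the product basis
`e_i ⊗ f_j`, which is indexed by `Fin dA × Fin dB`. -/
abbrev BipartiteUnitary (dA dB : ℕ) : Type :=
  Matrix.unitaryGroup (Fin dA × Fin dB) ℂ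

/-- The product vector `a ⊗ b`, with coordinate `a i * b j` at `e_i ⊗ f_j`. -/
def tensorVec {dA dB : ℕ} (a : Fin dA → ℂ) (b : Fin dB → ℂ) : Fin dA × Fin dB → ℂ :=
  fun p => a p.1 * b p.2

/-- A bipartite vector is entangled if it is not a product vector. -/
def IsEntangled {dA dB : ℕ} (ψ : Fin dA × Fin dB → ℂ) : Prop :=
  ¬ ∃ (a : Fin dA → ℂ) (b : Fin dB → ℂ), ψ = tensorVec a b

/-- `V` is imprimitive if it maps some product vector to an entangled vector. -/
def IsImprimitive {dA dB : ℕ} (V : BipartiteUnitary dA dB) : Prop :=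
  ∃ (a : Fin dA → ℂ) (b : Fin dB → ℂ),
    IsEntangled ((V : Matrix (Fin dA × Fin dB) (Fin dA × Fin dB) ℂ).mulVec (tensorVec a b))

/-- The local unitaries `U_A ⊗ U_B`. -/
def localUnitaries (dA dB : ℕ) : Set (BipartiteUnitary dA dB) :=
  {W | ∃ (UA : Matrix.unitaryGroup (Fin dA) ℂ) (UB : Matrix.unitaryGroup (Fin dB) ℂ),
    (W : Matrix (Fin dA × Fin dB) (Fin dA × Fin dB) ℂ) =
      (UA : Matrix (Fin dA) (Fin dA) ℂ) ⊗ₖ (UB : Matrix (Fin dB) (Fin dB) ℂ)}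

/-- The matrix of the SWAP gate `e_k ⊗ f_l ↦ e_l ⊗ f_k`, for factors of equal dimension. -/
def swapMatrix {dA dB : ℕ} (h : dA = dB) :
    Matrix (Fin dA × Fin dB) (Fin dA × Fin dB) ℂ :=
  Matrix.of fun p q => if Fin.cast h p.1 = q.2 ∧ p.2 = Fin.cast h q.1 then 1 else 0

/-- The gates `SWAP * (U_A ⊗ U_B)`; there are none unless `dA = dB`. -/
def swapLocalUnitaries (dA dB : ℕ) : Set (BipartiteUnitary dA dB) :=
  {W | ∃ (h : dA = dB) (UA : Matrix.unitaryGroup (Fin dA) ℂ)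
      (UB : Matrix.unitaryGroup (Fin dB) ℂ),
    (W : Matrix (Fin dA × Fin dB) (Fin dA × Fin dB) ℂ) =
      swapMatrix h *
        ((UA : Matrix (Fin dA) (Fin dA) ℂ) ⊗ₖ (UB : Matrix (Fin dB) (Fin dB) ℂ))}

/-- The gate set consisting of all local unitaries together with the single gate `V`. -/
def gateSet {dA dB : ℕ} (V : BipartiteUnitary dA dB) : Set (BipartiteUnitary dA dB) :=
  localUnitaries dA dB ∪ {V}

/-- `S` is exactly universal for `G` if each element of `G` is a finite product of elements
of `S`, with no inverses allowed. -/
def IsExactlyUniversal {G : Type*} [Group G] (S : Set G) : Prop :=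
  ∀ W : G, ∃ l : List G, l ≠ [] ∧ (∀ U ∈ l, U ∈ S) ∧ W = l.prod

end BipartiteGates

/-!
A unitary `V` that maps product vectors to product vectors is determined by linear algebra. A linear
family of product vectors has a common factor on one side (`common_factor_of_linear`), and for the
families `b ↦ V (a ⊗ b)` the side does not depend on `a` (`common_factor_uniform`). A common first
factor makes `V` an elementary tensor; a common second factor, for both choices of the distinguished
tensor factor, forces `dA = dB` and reduces to the first case after composing with the swap.

For universality, consider the directions, at a word `P` in the gates, in which products of words of
fixed length can be varied. They form real subspaces of the Lie algebra of skew-adjoint operators,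
and concatenation of words gives the rule `D + P D' P⁻¹`, so that there is a largest such subspace
`D`; it contains the Lie algebra of the local unitaries and is invariant under conjugation by all
gates (`exists_isReachable_maximal`). No inverses of gates are needed, since `P D P⁻¹ ⊆ D` is an
equality for reasons of dimension.

The complexification `M` of `D` contains the local operators `X ⊗ 1 + 1 ⊗ Y`. By
`eq_top_of_localOperators_lt`, invariance under local unitaries leaves only two possibilities:
`M` is the space of local operators, or everything. In the first case `V` normalizes the local
operators, and then it maps product vectors to product vectors (`not_isImprimitive_of_normalizes`). So
if `V` is imprimitive, `D` is the full Lie algebra. The inverse function theorem, applied to the skew-adjoint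
part of the word map, shows that words of some fixed length fill a neighbourhood of `P`
(`IsReachable.exists_nhds_subset`). As `P⁻¹` is a limit of positive powers of `P`, longer words fill
a neighbourhood of `1`, and exponentials together with compactness of the unitary group give a
uniform length for all unitaries (`exists_pow_eq_univ_of_nhds`).
-/

namespace BipartiteGates

open Matrix

/-! ### Product vectors -/

lemma kronecker_mulVec_tensorVec {dA dB : ℕ} (U : Matrix (Fin dA) (Fin dA) ℂ)
    (W : Matrix (Fin dB) (Fin dB) ℂ) (a : Fin dA → ℂ) (b : Fin dB → ℂ) :
    (U ⊗ₖ W) *ᵥ tensorVec a b = tensorVec (U *ᵥ a) (W *ᵥ b) := by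
  ext ⟨i, k⟩
  simp only [mulVec, dotProduct, tensorVec, kroneckerMap_apply, Fintype.sum_prod_type,
    Finset.sum_mul_sum]
  exact Finset.sum_congr rfl fun _ _ => Finset.sum_congr rfl fun _ _ => by ring

lemma tensorVec_single {dA dB : ℕ} (i : Fin dA) (k : Fin dB) :
    tensorVec (Pi.single i 1) (Pi.single k 1) = Pi.single (i, k) (1 : ℂ) := by
  ext ⟨i', k'⟩
  by_cases h1 : i' = i <;> by_cases h2 : k' = k <;> simp [tensorVec, h1, h2]

lemma tensorVec_smul_smul {dA dB : ℕ} (r s : ℂ) (a : Fin dA → ℂ) (b : Fin dB → ℂ) :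
    tensorVec (r • a) (s • b) = (r * s) • tensorVec a b := by
  ext ⟨i, k⟩
  simp only [tensorVec, Pi.smul_apply, smul_eq_mul]
  ring

lemma dotProduct_tensorVec {dA dB : ℕ} (c a : Fin dA → ℂ) (d b : Fin dB → ℂ) :
    tensorVec c d ⬝ᵥ tensorVec a b = (c ⬝ᵥ a) * (d ⬝ᵥ b) := by
  simp only [dotProduct, tensorVec, Fintype.sum_prod_type, Finset.sum_mul_sum]
  exact Finset.sum_congr rfl fun _ _ => Finset.sum_congr rfl fun _ _ => by ring

lemma star_tensorVec {dA dB : ℕ} (a : Fin dA → ℂ) (b : Fin dB → ℂ) :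
    star (tensorVec a b) = tensorVec (star a) (star b) := by
  ext p
  simp [tensorVec]

lemma zero_tensorVec {dA dB : ℕ} (b : Fin dB → ℂ) : tensorVec (0 : Fin dA → ℂ) b = 0 := by
  ext p
  simp [tensorVec]

lemma tensorVec_zero {dA dB : ℕ} (a : Fin dA → ℂ) : tensorVec a (0 : Fin dB → ℂ) = 0 := by
  ext p
  simp [tensorVec]

lemma add_tensorVec {dA dB : ℕ} (a a' : Fin dA → ℂ) (b : Fin dB → ℂ) :
    tensorVec (a + a') b = tensorVec a b + tensorVec a' b := by
  ext
  simp [tensorVec, add_mul]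

lemma tensorVec_add {dA dB : ℕ} (a : Fin dA → ℂ) (b b' : Fin dB → ℂ) :
    tensorVec a (b + b') = tensorVec a b + tensorVec a b' := by
  ext
  simp [tensorVec, mul_add]

/-! ### Local operators -/

/-- The complexified Lie algebra of the local unitaries: the operators `X ⊗ 1 + 1 ⊗ Y`. -/
def localOperators (dA dB : ℕ) :
    Submodule ℂ (Matrix (Fin dA × Fin dB) (Fin dA × Fin dB) ℂ) where
  carrier := {T | ∃ (X : Matrix (Fin dA) (Fin dA) ℂ) (Y : Matrix (Fin dB) (Fin dB) ℂ),
    T = X ⊗ₖ 1 + 1 ⊗ₖ Y}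
  zero_mem' := ⟨0, 0, by simp⟩
  add_mem' := by
    rintro _ _ ⟨X, Y, rfl⟩ ⟨X', Y', rfl⟩
    exact ⟨X + X', Y + Y', by rw [add_kronecker, kronecker_add]; abel⟩
  smul_mem' := by
    rintro z _ ⟨X, Y, rfl⟩
    exact ⟨z • X, z • Y, by rw [smul_kronecker, kronecker_smul, smul_add]⟩

lemma conjTranspose_mem_localOperators {dA dB : ℕ}
    {T : Matrix (Fin dA × Fin dB) (Fin dA × Fin dB) ℂ} (hT : T ∈ localOperators dA dB) :
    Tᴴ ∈ localOperators dA dB := by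
  obtain ⟨X, Y, rfl⟩ := hT
  exact ⟨Xᴴ, Yᴴ, by simp [conjTranspose_kronecker]⟩

/-- A matrix with vanishing matrix elements between orthogonal vectors is scalar; the vectors
`e_i + e_j` and `e_i - e_j` compare its diagonal entries. -/
lemma exists_eq_smul_one {n : Type*} [Fintype n] [DecidableEq n] (X : Matrix n n ℂ)
    (h : ∀ c a : n → ℂ, star c ⬝ᵥ a = 0 → star c ⬝ᵥ X *ᵥ a = 0) :
    ∃ z : ℂ, X = z • (1 : Matrix n n ℂ) := by
  have hoff : ∀ i j, i ≠ j → X i j = 0 := by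
    intro i j hij
    have := h (Pi.single i 1) (Pi.single j 1) (by simp [hij])
    simpa [← Pi.single_star] using this
  have hdiag : ∀ i j, X i i = X j j := by
    intro i j
    by_cases hij : i = j
    · rw [hij]
    have := h (Pi.single i 1 + Pi.single j 1) (Pi.single i 1 - Pi.single j 1)
      (by simp [hij, Ne.symm hij])
    simp [add_dotProduct, mulVec_sub, hoff i j hij,
      hoff j i (Ne.symm hij)] at this
    linear_combination this
  cases isEmpty_or_nonempty n with
  | inl _ => exact ⟨0, Subsingleton.elim _ _⟩
  | inr hn =>
    obtain ⟨i₀⟩ := hn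
    refine ⟨X i₀ i₀, ?_⟩
    ext i j
    by_cases hij : i = j
    · subst hij; simp [hdiag i i₀]
    · simp [hoff i j hij, hij]

/-- The matrix elements of `T` between product vectors, computed from the `dA × dA` blocks
`(T (i, k) (j, l))_ij`. -/
lemma dotProduct_mulVec_tensorVec {dA dB : ℕ} (T : Matrix (Fin dA × Fin dB) (Fin dA × Fin dB) ℂ)
    (c a : Fin dA → ℂ) (d b : Fin dB → ℂ) :
    star (tensorVec c d) ⬝ᵥ T *ᵥ tensorVec a b =
      star d ⬝ᵥ (Matrix.of fun k l =>
        star c ⬝ᵥ (Matrix.of fun i j => T (i, k) (j, l)) *ᵥ a) *ᵥ b := by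
  simp only [dotProduct, mulVec, tensorVec, Pi.star_apply, of_apply, Fintype.sum_prod_type,
    Finset.mul_sum, Finset.sum_mul, star_mul']
  rw [Finset.sum_comm]
  refine Finset.sum_congr rfl fun k _ => ?_
  rw [Finset.sum_comm (γ := Fin dB)]
  refine Finset.sum_congr rfl fun i _ => ?_
  rw [Finset.sum_comm]
  refine Finset.sum_congr rfl fun j _ => Finset.sum_congr rfl fun l _ => ?_
  ring

/-- An operator is local as soon as all its matrix elements between "doubly orthogonal" product
vectors vanish. -/
lemma mem_localOperators_of_forall_orthogonal {dA dB : ℕ}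
    (T : Matrix (Fin dA × Fin dB) (Fin dA × Fin dB) ℂ)
    (h : ∀ (c a : Fin dA → ℂ) (d b : Fin dB → ℂ), star c ⬝ᵥ a = 0 → star d ⬝ᵥ b = 0 →
      star (tensorVec c d) ⬝ᵥ T *ᵥ tensorVec a b = 0) :
    T ∈ localOperators dA dB := by
  set B : Fin dB → Fin dB → Matrix (Fin dA) (Fin dA) ℂ :=
    fun k l => Matrix.of fun i j => T (i, k) (j, l) with hB
  have key : ∀ c a : Fin dA → ℂ, star c ⬝ᵥ a = 0 → ∃ z : ℂ,
      (Matrix.of fun k l => star c ⬝ᵥ B k l *ᵥ a) = z • (1 : Matrix (Fin dB) (Fin dB) ℂ) := by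
    intro c a hca
    refine exists_eq_smul_one _ fun d b hdb => ?_
    rw [← h c a d b hca hdb, dotProduct_mulVec_tensorVec]
  have hoff : ∀ k l, k ≠ l → ∃ z : ℂ, B k l = z • (1 : Matrix (Fin dA) (Fin dA) ℂ) := by
    intro k l hkl
    refine exists_eq_smul_one _ fun c a hca => ?_
    obtain ⟨z, hz⟩ := key c a hca
    simpa [hkl] using congrFun₂ hz k l
  have hdiag : ∀ k l, ∃ z : ℂ, B k k - B l l = z • (1 : Matrix (Fin dA) (Fin dA) ℂ) := by
    intro k l
    refine exists_eq_smul_one _ fun c a hca => ?_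
    obtain ⟨z, hz⟩ := key c a hca
    have h1 := congrFun₂ hz k k
    have h2 := congrFun₂ hz l l
    simp only [of_apply, Matrix.smul_apply, one_apply_eq] at h1 h2
    rw [sub_mulVec, dotProduct_sub, h1, h2, sub_self]
  cases isEmpty_or_nonempty (Fin dB) with
  | inl _ => exact ⟨0, 0, Subsingleton.elim _ _⟩
  | inr hn =>
    obtain ⟨k₀⟩ := hn
    have hall : ∀ k l, ∃ z : ℂ, B k l =
        z • (1 : Matrix (Fin dA) (Fin dA) ℂ) + (if k = l then B k₀ k₀ else 0) := by
      intro k l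
      by_cases hkl : k = l
      · subst hkl
        obtain ⟨z, hz⟩ := hdiag k k₀
        exact ⟨z, by rw [← hz]; simp⟩
      · obtain ⟨z, hz⟩ := hoff k l hkl
        exact ⟨z, by simp [hz, hkl]⟩
    choose y hy using hall
    refine ⟨B k₀ k₀, Matrix.of y, ?_⟩
    ext ⟨i, k⟩ ⟨j, l⟩
    have : T (i, k) (j, l) = B k l i j := rfl
    rw [this, hy k l]
    by_cases hkl : k = l <;> by_cases hij : i = j <;>
      simp [one_apply, hkl, hij, add_comm]

end BipartiteGates

namespace BipartiteGates

open Matrix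

open scoped ComplexOrder

/-! ### Subspaces invariant under conjugation by local unitaries -/

/-- If a complex subspace is invariant under conjugation by `1 + (z - 1) P` for all `|z| = 1`, where
`P` is the coordinate projection onto `s`, then it is invariant under `T ↦ P T (1 - P)`, because
conjugation by `1 + (z - 1) P` multiplies `P T (1 - P)` by `z`, its transposed block by `z⁻¹`, and
fixes the two diagonal blocks. -/
lemma offDiagonal_block_mem {ι : Type*} [Fintype ι] [DecidableEq ι]
    (M : Submodule ℂ (Matrix ι ι ℂ)) (s : ι → Prop) [DecidablePred s]
    (hM : ∀ z : ℂ, star z * z = 1 → ∀ T ∈ M, diagonal (fun p => if s p then z else 1) * T *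
      (diagonal (fun p => if s p then z else 1))ᴴ ∈ M)
    {T : Matrix ι ι ℂ} (hT : T ∈ M) :
    Matrix.of (fun p q => if s p ∧ ¬ s q then T p q else 0) ∈ M := by
  have h1 := hM Complex.I (by simp) T hT
  have h2 := hM (-1) (by simp) T hT
  have h3 := M.smul_mem (1 / (2 * Complex.I))
    (M.sub_mem (M.sub_mem h1 hT) (M.smul_mem ((1 + Complex.I) / 2) (M.sub_mem h2 hT)))
  convert h3 using 1
  ext p q
  have hI := Complex.I_mul_I
  have hI0 := Complex.I_ne_zero
  by_cases hp : s p <;> by_cases hq : s q <;>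
    simp [diagonal_conjTranspose, mul_diagonal, diagonal_mul, hp, hq]
  all_goals field_simp
  all_goals ring_nf
  all_goals simp [Complex.I_sq]

lemma diagonal_ite_mem_unitaryGroup {n : Type*} [Fintype n] [DecidableEq n] (s : n → Prop)
    [DecidablePred s]
    {z : ℂ} (hz : star z * z = 1) :
    diagonal (fun p => if s p then z else 1) ∈ Matrix.unitaryGroup n ℂ := by
  rw [mem_unitaryGroup_iff', star_eq_conjTranspose, diagonal_conjTranspose,
    diagonal_mul_diagonal, ← diagonal_one]
  congr 1
  ext p
  have hz' : (starRingEnd ℂ) z * z = 1 := hz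
  by_cases hp : s p <;> simp [hp, hz']

/-- A matrix unit `E_ij ⊗ E_kl` with `i ≠ j` and `k ≠ l` lies in every subspace that is invariant
under conjugation by local unitaries and that contains an operator with a nonzero entry there. -/
lemma single_mem_of_apply_ne_zero {dA dB : ℕ}
    (M : Submodule ℂ (Matrix (Fin dA × Fin dB) (Fin dA × Fin dB) ℂ))
    (hM : ∀ U ∈ Matrix.unitaryGroup (Fin dA) ℂ, ∀ W ∈ Matrix.unitaryGroup (Fin dB) ℂ,
      ∀ T ∈ M, (U ⊗ₖ W) * T * (U ⊗ₖ W)ᴴ ∈ M)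
    {T : Matrix (Fin dA × Fin dB) (Fin dA × Fin dB) ℂ} (hT : T ∈ M)
    {i j : Fin dA} {k l : Fin dB} (hij : i ≠ j) (hkl : k ≠ l) (h : T (i, k) (j, l) ≠ 0) :
    Matrix.single (i, k) (j, l) (1 : ℂ) ∈ M := by
  have hA : ∀ (s : Fin dA → Prop) [DecidablePred s], ∀ T ∈ M,
      Matrix.of (fun p q : Fin dA × Fin dB => if s p.1 ∧ ¬ s q.1 then T p q else 0) ∈ M := by
    intro s _ T hT
    refine offDiagonal_block_mem M (fun p => s p.1) (fun z hz T hT => ?_) hT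
    have := hM _ (diagonal_ite_mem_unitaryGroup s hz) 1 (one_mem _) T hT
    rw [← diagonal_one, diagonal_kronecker_diagonal] at this
    simpa using this
  have hB : ∀ (s : Fin dB → Prop) [DecidablePred s], ∀ T ∈ M,
      Matrix.of (fun p q : Fin dA × Fin dB => if s p.2 ∧ ¬ s q.2 then T p q else 0) ∈ M := by
    intro s _ T hT
    refine offDiagonal_block_mem M (fun p => s p.2) (fun z hz T hT => ?_) hT
    have := hM 1 (one_mem _) _ (diagonal_ite_mem_unitaryGroup s hz) T hT
    rw [← diagonal_one, diagonal_kronecker_diagonal] at this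
    simpa using this
  -- The compressions to row index `(i, k)` and column index `(j, l)`. The complements of `{j}` and
  -- `{l}` are used for the columns because `offDiagonal_block_mem` compresses columns to `¬ s`.
  have h4 := M.smul_mem (T (i, k) (j, l))⁻¹
    (hB (fun x => ¬ x = l) _ (hB (fun x => x = k) _ (hA (fun x => ¬ x = j) _
      (hA (fun x => x = i) _ hT))))
  convert h4 using 1
  ext ⟨i', k'⟩ ⟨j', l'⟩
  simp only [Matrix.single_apply, of_apply, Matrix.smul_apply, Prod.mk.injEq, smul_eq_mul]
  split_ifs <;> grind

lemma nontrivial_of_orthogonal {d : ℕ} {c a : Fin d → ℂ} (hc : c ≠ 0) (ha : a ≠ 0)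
    (hca : star c ⬝ᵥ a = 0) : Nontrivial (Fin d) := by
  by_contra hn
  rw [not_nontrivial_iff_subsingleton] at hn
  obtain ⟨i, hi⟩ := Function.ne_iff.mp hc
  obtain ⟨j, hj⟩ := Function.ne_iff.mp ha
  obtain rfl := Subsingleton.elim i j
  rw [dotProduct, Fintype.sum_subsingleton _ i] at hca
  simp at hca hi hj
  tauto

/-- Any two orthogonal nonzero vectors are, up to scale, two prescribed columns of a unitary. -/
lemma exists_unitary_of_orthogonal {d : ℕ} {c a : Fin d → ℂ} (hc : c ≠ 0) (ha : a ≠ 0)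
    (hca : star c ⬝ᵥ a = 0) {i j : Fin d} (hij : i ≠ j) :
    ∃ U ∈ Matrix.unitaryGroup (Fin d) ℂ, ∃ r s : ℂ, r ≠ 0 ∧ s ≠ 0 ∧
      U *ᵥ Pi.single i 1 = r • c ∧ U *ᵥ Pi.single j 1 = s • a := by
  set v : Fin d → EuclideanSpace ℂ (Fin d) := fun x =>
    if x = i then ((‖WithLp.toLp 2 c‖⁻¹ : ℝ) : ℂ) • WithLp.toLp 2 c
    else ((‖WithLp.toLp 2 a‖⁻¹ : ℝ) : ℂ) • WithLp.toLp 2 a with hv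
  have hin : inner ℂ (WithLp.toLp 2 c) (WithLp.toLp 2 a) = (0 : ℂ) := by
    rw [EuclideanSpace.inner_toLp_toLp, dotProduct_comm, hca]
  have hin' : inner ℂ (WithLp.toLp 2 a) (WithLp.toLp 2 c) = (0 : ℂ) := by
    rw [← inner_conj_symm, hin, map_zero]
  have hon : Orthonormal ℂ (({i, j} : Set (Fin d)).domRestrict v) := by
    constructor
    · rintro ⟨x, hx⟩
      by_cases hxi : x = i <;> simp [hv, hxi, norm_smul, hc, ha, Set.domRestrict]
    · have hji := hij.symm
      rintro ⟨x, hx⟩ ⟨y, hy⟩ hxy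
      simp only [Set.mem_insert_iff, Set.mem_singleton_iff] at hx hy
      rcases hx with rfl | rfl <;> rcases hy with rfl | rfl <;>
        simp_all [inner_smul_left, inner_smul_right, Set.domRestrict]
  obtain ⟨b, hb⟩ := hon.exists_orthonormalBasis_extension_of_card_eq (by simp)
  refine ⟨(EuclideanSpace.basisFun (Fin d) ℂ).toBasis.toMatrix b,
    (EuclideanSpace.basisFun (Fin d) ℂ).toMatrix_orthonormalBasis_mem_unitary b,
    ((‖WithLp.toLp 2 c‖⁻¹ : ℝ) : ℂ), ((‖WithLp.toLp 2 a‖⁻¹ : ℝ) : ℂ), by simpa using hc,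
      by simpa using ha, ?_, ?_⟩
  · ext x
    have := hb i (by simp)
    simp [Module.Basis.toMatrix_apply, this, hv]
  · ext x
    have := hb j (by simp)
    simp [Module.Basis.toMatrix_apply, this, hv, hij.symm]

/-- The entries of `T` in a rotated product basis. -/
lemma conj_kronecker_apply {dA dB : ℕ} (T : Matrix (Fin dA × Fin dB) (Fin dA × Fin dB) ℂ)
    (U : Matrix (Fin dA) (Fin dA) ℂ) (W : Matrix (Fin dB) (Fin dB) ℂ)
    (i j : Fin dA) (k l : Fin dB) :
    ((U ⊗ₖ W)ᴴ * T * (U ⊗ₖ W)) (i, k) (j, l) =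
      star (tensorVec (U *ᵥ Pi.single i 1) (W *ᵥ Pi.single k 1)) ⬝ᵥ
        T *ᵥ tensorVec (U *ᵥ Pi.single j 1) (W *ᵥ Pi.single l 1) := by
  rw [← kronecker_mulVec_tensorVec, ← kronecker_mulVec_tensorVec, tensorVec_single,
    tensorVec_single, star_mulVec, ← dotProduct_mulVec, mulVec_mulVec, mulVec_mulVec]
  simp

/-- The Lie-algebraic dichotomy: a complex subspace containing the local operators and invariant
under conjugation by local unitaries is either the space of local operators or everything. -/
lemma eq_top_of_localOperators_lt {dA dB : ℕ}
    (M : Submodule ℂ (Matrix (Fin dA × Fin dB) (Fin dA × Fin dB) ℂ))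
    (hM : ∀ U ∈ Matrix.unitaryGroup (Fin dA) ℂ, ∀ W ∈ Matrix.unitaryGroup (Fin dB) ℂ,
      ∀ T ∈ M, (U ⊗ₖ W) * T * (U ⊗ₖ W)ᴴ ∈ M)
    (hlt : localOperators dA dB < M) : M = ⊤ := by
  obtain ⟨hle, T, hT, hTn⟩ := Set.ssubset_iff_exists.mp hlt
  -- A nonlocal element of `M` has a nonzero matrix element between doubly orthogonal vectors, which
  -- a local change of basis turns into the entry at `(i, k)`, `(j, l)`.
  have hne : ∃ (c a : Fin dA → ℂ) (d b : Fin dB → ℂ), star c ⬝ᵥ a = 0 ∧ star d ⬝ᵥ b = 0 ∧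
      star (tensorVec c d) ⬝ᵥ T *ᵥ tensorVec a b ≠ 0 := by
    by_contra! h
    exact hTn (mem_localOperators_of_forall_orthogonal T h)
  obtain ⟨c, a, d, b, hca, hdb, hne⟩ := hne
  have hc : c ≠ 0 := by rintro rfl; simp [zero_tensorVec] at hne
  have ha : a ≠ 0 := by rintro rfl; simp [zero_tensorVec] at hne
  have hd : d ≠ 0 := by rintro rfl; simp [tensorVec_zero] at hne
  have hb : b ≠ 0 := by rintro rfl; simp [tensorVec_zero] at hne
  obtain ⟨i, j, hij⟩ := nontrivial_of_orthogonal hc ha hca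
  obtain ⟨k, l, hkl⟩ := nontrivial_of_orthogonal hd hb hdb
  have hE : Matrix.single (i, k) (j, l) (1 : ℂ) ∈ M := by
    obtain ⟨U, hU, r, s, hr, hs, hUi, hUj⟩ := exists_unitary_of_orthogonal hc ha hca hij
    obtain ⟨W, hW, r', s', hr', hs', hWk, hWl⟩ := exists_unitary_of_orthogonal hd hb hdb hkl
    have hT' := hM _ (Unitary.star_mem hU) _ (Unitary.star_mem hW) T hT
    simp only [star_eq_conjTranspose, ← conjTranspose_kronecker, conjTranspose_conjTranspose] at hT'
    refine single_mem_of_apply_ne_zero M hM hT' hij hkl ?_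
    rw [conj_kronecker_apply, hUi, hUj, hWk, hWl, tensorVec_smul_smul, tensorVec_smul_smul,
      star_smul, smul_dotProduct, mulVec_smul, dotProduct_smul]
    simp [*]
  by_contra hMtop
  obtain ⟨f, hf0, hf⟩ := Submodule.exists_le_ker_of_lt_top M (lt_top_iff_ne_top.mpr hMtop)
  -- The functional `f` is represented by `Z` through the trace form.
  set Z : Matrix (Fin dA × Fin dB) (Fin dA × Fin dB) ℂ :=
    Matrix.of fun q p => f (Matrix.single p q 1) with hZ
  have hfZ : ∀ T, f T = (Z * T).trace := by
    intro T
    conv_lhs => rw [matrix_eq_sum_single T]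
    simp only [map_sum, Matrix.trace, Matrix.mul_apply, diag_apply]
    rw [Finset.sum_comm]
    refine Finset.sum_congr rfl fun p _ => Finset.sum_congr rfl fun q _ => ?_
    have : Matrix.single q p (T q p) = T q p • Matrix.single q p (1 : ℂ) := by simp
    rw [this, map_smul, hZ, of_apply, smul_eq_mul, mul_comm]
  -- All local conjugates of the matrix unit `E_(i,k),(j,l)` lie in `M`, so `Z` is local.
  have hZloc : Z ∈ localOperators dA dB := by
    refine mem_localOperators_of_forall_orthogonal Z fun a c b d hac hbd => ?_
    by_cases hc : c = 0
    · simp [hc, zero_tensorVec]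
    by_cases ha : a = 0
    · simp [ha, zero_tensorVec]
    by_cases hd : d = 0
    · simp [hd, tensorVec_zero]
    by_cases hb : b = 0
    · simp [hb, tensorVec_zero]
    obtain ⟨U, hU, r, s, hr, hs, hUi, hUj⟩ := exists_unitary_of_orthogonal ha hc hac hij.symm
    obtain ⟨W, hW, r', s', hr', hs', hWk, hWl⟩ := exists_unitary_of_orthogonal hb hd hbd hkl.symm
    have h1 : f ((U ⊗ₖ W) * Matrix.single (i, k) (j, l) 1 * (U ⊗ₖ W)ᴴ) = 0 :=
      hf (hM U hU W hW _ hE)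
    rw [hfZ, ← Matrix.mul_assoc, Matrix.trace_mul_comm, ← Matrix.mul_assoc, ← Matrix.mul_assoc,
      Matrix.trace_mul_single, conj_kronecker_apply, hUi, hUj, hWk, hWl, tensorVec_smul_smul,
      tensorVec_smul_smul,
      star_smul, smul_dotProduct, mulVec_smul, dotProduct_smul] at h1
    simpa [hr, hs, hr', hs'] using h1
  -- Hence `Z⋆ ∈ M`, and `f` vanishes on it.
  have h2 : (Z * Zᴴ).trace = 0 := by
    rw [← hfZ]
    exact hf (hle (conjTranspose_mem_localOperators hZloc))
  rw [Matrix.trace_mul_conjTranspose_self_eq_zero_iff] at h2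
  exact hf0 (LinearMap.ext fun T => by simp [hfZ, h2])

end BipartiteGates

namespace BipartiteGates

open Matrix

/-! ### Unitaries normalizing the local operators -/

/-- An idempotent of the form `X ⊗ 1 + 1 ⊗ Y` acts on one factor only: squaring it produces the
cross term `2 X ⊗ Y`, which is local only if `X` or `Y` is scalar. -/
lemma exists_eq_kronecker_of_idempotent {dA dB : ℕ}
    {Z : Matrix (Fin dA × Fin dB) (Fin dA × Fin dB) ℂ} (hZ : Z ∈ localOperators dA dB)
    (hid : Z * Z = Z) :
    ∃ (A : Matrix (Fin dA) (Fin dA) ℂ) (B : Matrix (Fin dB) (Fin dB) ℂ), Z = A ⊗ₖ B := by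
  obtain ⟨X, Y, rfl⟩ := hZ
  by_cases hX : ∃ x : ℂ, X = x • (1 : Matrix (Fin dA) (Fin dA) ℂ)
  · obtain ⟨x, rfl⟩ := hX
    exact ⟨1, x • 1 + Y, by rw [kronecker_add, smul_kronecker, kronecker_smul]⟩
  by_cases hY : ∃ y : ℂ, Y = y • (1 : Matrix (Fin dB) (Fin dB) ℂ)
  · obtain ⟨y, rfl⟩ := hY
    exact ⟨X + y • 1, 1, by rw [add_kronecker, smul_kronecker, kronecker_smul]⟩
  exfalso
  have h1 := mt (exists_eq_smul_one X) hX
  have h2 := mt (exists_eq_smul_one Y) hY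
  push Not at h1 h2
  obtain ⟨c, a, hca, hX⟩ := h1
  obtain ⟨d, b, hdb, hY⟩ := h2
  have h := congrArg (fun T => star (tensorVec c d) ⬝ᵥ T *ᵥ tensorVec a b) hid
  simp only [Matrix.mul_add, Matrix.add_mul, ← mul_kronecker_mul, Matrix.one_mul, Matrix.mul_one,
    add_mulVec, dotProduct_add, kronecker_mulVec_tensorVec, star_tensorVec, dotProduct_tensorVec,
    one_mulVec, hca, hdb] at h
  apply mul_ne_zero hX hY
  linear_combination h / 2

lemma eq_tensorVec_of_kronecker_eq_vecMulVec {dA dB : ℕ} {A : Matrix (Fin dA) (Fin dA) ℂ}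
    {B : Matrix (Fin dB) (Fin dB) ℂ} {ψ φ : Fin dA × Fin dB → ℂ} (h : A ⊗ₖ B = vecMulVec ψ φ)
    (hφ : φ ≠ 0) : ∃ (a : Fin dA → ℂ) (b : Fin dB → ℂ), ψ = tensorVec a b := by
  obtain ⟨⟨j, l⟩, hjl⟩ := Function.ne_iff.mp hφ
  refine ⟨fun i => A i j / φ (j, l), fun k => B k l, ?_⟩
  ext ⟨i, k⟩
  have := congrFun₂ h (i, k) (j, l)
  simp only [kroneckerMap_apply, vecMulVec_apply] at this
  simp only [Pi.zero_apply] at hjl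
  simp only [tensorVec]
  field_simp
  rw [this]

/-- A unitary that normalizes the algebra of local operators maps product vectors to product
vectors. The projections `P ⊗ 1` and `1 ⊗ Q` onto the two factors of a product vector `ψ` are
carried to local idempotents, whose product is an elementary tensor of rank one with range spanned
by `V ψ`. -/
lemma not_isImprimitive_of_normalizes {dA dB : ℕ} (V : BipartiteUnitary dA dB)
    (hV : ∀ T ∈ localOperators dA dB, V.1 * T * V.1ᴴ ∈ localOperators dA dB) :
    ¬ IsImprimitive V := by
  rintro ⟨a, b, hab⟩
  apply hab
  by_cases ha : a = 0
  · exact ⟨0, 0, by simp [ha, zero_tensorVec]⟩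
  by_cases hb : b = 0
  · exact ⟨0, 0, by simp [hb, tensorVec_zero]⟩
  have hVV : V.1ᴴ * V.1 = 1 := mem_unitaryGroup_iff'.mp V.2
  have hdual : ∀ {d : ℕ} (a : Fin d → ℂ), a ≠ 0 → ∃ a' : Fin d → ℂ, a' ⬝ᵥ a = 1 := by
    intro d a ha
    obtain ⟨i, hi⟩ := Function.ne_iff.mp ha
    exact ⟨Pi.single i (a i)⁻¹, by simpa using inv_mul_cancel₀ hi⟩
  obtain ⟨a', ha'⟩ := hdual a ha
  obtain ⟨b', hb'⟩ := hdual b hb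
  have hconj : ∀ S T : Matrix (Fin dA × Fin dB) (Fin dA × Fin dB) ℂ,
      (V.1 * S * V.1ᴴ) * (V.1 * T * V.1ᴴ) = V.1 * (S * T) * V.1ᴴ := by
    intro S T
    calc _ = V.1 * S * (V.1ᴴ * V.1) * T * V.1ᴴ := by simp only [Matrix.mul_assoc]
      _ = _ := by rw [hVV]; simp only [Matrix.mul_assoc, Matrix.mul_one]
  have hidem : ∀ {d : ℕ} (a a' : Fin d → ℂ), a' ⬝ᵥ a = 1 →
      vecMulVec a a' * vecMulVec a a' = vecMulVec a a' := by
    intro d a a' h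
    rw [vecMulVec_mul_vecMulVec, h]
    simp
  obtain ⟨A₁, B₁, h₁⟩ := exists_eq_kronecker_of_idempotent
    (hV (vecMulVec a a' ⊗ₖ 1) ⟨vecMulVec a a', 0, by simp⟩)
    (by rw [hconj, ← mul_kronecker_mul, hidem a a' ha', Matrix.one_mul])
  obtain ⟨A₂, B₂, h₂⟩ := exists_eq_kronecker_of_idempotent
    (hV (1 ⊗ₖ vecMulVec b b') ⟨0, vecMulVec b b', by simp⟩)
    (by rw [hconj, ← mul_kronecker_mul, hidem b b' hb', Matrix.one_mul])
  have h₃ : vecMulVec a a' ⊗ₖ vecMulVec b b' = vecMulVec (tensorVec a b) (tensorVec a' b') := by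
    ext p q
    simp only [kroneckerMap_apply, vecMulVec_apply, tensorVec]
    ring
  refine eq_tensorVec_of_kronecker_eq_vecMulVec (A := A₁ * A₂) (B := B₁ * B₂)
    (φ := tensorVec a' b' ᵥ* V.1ᴴ) ?_ ?_
  · rw [mul_kronecker_mul, ← h₁, ← h₂, hconj, ← mul_kronecker_mul, Matrix.one_mul,
      Matrix.mul_one, h₃, mul_vecMulVec, vecMulVec_mul]
  · intro h0
    have : (tensorVec a' b' ᵥ* V.1ᴴ) ⬝ᵥ (V.1 *ᵥ tensorVec a b) = 1 := by
      rw [← dotProduct_mulVec, mulVec_mulVec, hVV, one_mulVec, dotProduct_tensorVec, ha', hb',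
        one_mul]
    simp [h0] at this

end BipartiteGates

namespace BipartiteGates

open Matrix

open scoped ComplexOrder

/-! ### Unitaries preserving product vectors -/

/-- The vanishing of all `2 × 2` minors of `(x, x')`, with `x ≠ 0`, makes `x'` a multiple of `x`. -/
lemma exists_eq_smul_of_minors {n : Type*} {x x' : n → ℂ} (hx : x ≠ 0)
    (h : ∀ i j, x i * x' j = x j * x' i) : ∃ r : ℂ, x' = r • x := by
  obtain ⟨i, hi⟩ := Function.ne_iff.mp hx
  refine ⟨x' i / x i, ?_⟩
  ext j
  simp only [Pi.zero_apply] at hi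
  simp only [Pi.smul_apply, smul_eq_mul]
  field_simp
  linear_combination h i j

/-- If a sum of two product vectors is a product vector, the two summands have parallel first
factors or parallel second factors: the minors of `x yᵀ + x' y'ᵀ` are the products of the minors
of `(x, x')` and of `(y, y')`. -/
lemma minors_eq_of_tensorVec_add {dA dB : ℕ} {x x' p : Fin dA → ℂ} {y y' q : Fin dB → ℂ}
    (h : tensorVec x y + tensorVec x' y' = tensorVec p q) :
    (∀ i j, x i * x' j = x j * x' i) ∨ (∀ k l, y k * y' l = y l * y' k) := by
  by_contra! hne
  obtain ⟨⟨i, j, hij⟩, k, l, hkl⟩ := hne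
  have h1 := congrFun h (i, k)
  have h2 := congrFun h (i, l)
  have h3 := congrFun h (j, k)
  have h4 := congrFun h (j, l)
  simp only [tensorVec, Pi.add_apply] at h1 h2 h3 h4
  refine mul_ne_zero (sub_ne_zero.mpr hij) (sub_ne_zero.mpr hkl) ?_
  have : (x i * x' j - x j * x' i) * (y k * y' l - y l * y' k) =
      (x i * y k + x' i * y' k) * (x j * y l + x' j * y' l) -
        (x i * y l + x' i * y' l) * (x j * y k + x' j * y' k) := by ring
  rw [this, h1, h2, h3, h4]
  ring

/-- A linear family of product vectors has a common first factor or a common second factor. -/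
lemma common_factor_of_linear {E : Type*} [AddCommGroup E] [Module ℂ E] {dA dB : ℕ}
    (L : E →ₗ[ℂ] (Fin dA × Fin dB → ℂ)) (hL : ∀ e, ∃ x y, L e = tensorVec x y) :
    (∃ u, ∀ e, ∃ y, L e = tensorVec u y) ∨ (∃ w, ∀ e, ∃ x, L e = tensorVec x w) := by
  have hpar : ∀ e e' x y x' y', L e = tensorVec x y → L e' = tensorVec x' y' →
      (∀ i j, x i * x' j = x j * x' i) ∨ (∀ k l, y k * y' l = y l * y' k) := by
    intro e e' x y x' y' h h'
    obtain ⟨p, q, hpq⟩ := hL (e + e')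
    rw [map_add, h, h'] at hpq
    exact minors_eq_of_tensorVec_add hpq
  by_cases h0 : ∀ e, L e = 0
  · exact Or.inl ⟨0, fun e => ⟨0, by rw [h0, zero_tensorVec]⟩⟩
  push Not at h0
  obtain ⟨e₀, h0⟩ := h0
  obtain ⟨u, y, hu⟩ := hL e₀
  have hu0 : u ≠ 0 := by rintro rfl; rw [hu, zero_tensorVec] at h0; exact h0 rfl
  have hy0 : y ≠ 0 := by rintro rfl; rw [hu, tensorVec_zero] at h0; exact h0 rfl
  by_contra! hne
  obtain ⟨e₁, h1⟩ := hne.1 u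
  obtain ⟨e₂, h2⟩ := hne.2 y
  obtain ⟨x₁, y₁, he₁⟩ := hL e₁
  obtain ⟨x₂, y₂, he₂⟩ := hL e₂
  have hx1 : ¬ ∀ i j, u i * x₁ j = u j * x₁ i := by
    intro h
    obtain ⟨r, rfl⟩ := exists_eq_smul_of_minors hu0 h
    refine h1 (r • y₁) ?_
    rw [he₁]
    ext p
    simp only [tensorVec, Pi.smul_apply, smul_eq_mul]
    ring
  have hy2 : ¬ ∀ k l, y k * y₂ l = y l * y₂ k := by
    intro h
    obtain ⟨r, rfl⟩ := exists_eq_smul_of_minors hy0 h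
    refine h2 (r • x₂) ?_
    rw [he₂]
    ext p
    simp only [tensorVec, Pi.smul_apply, smul_eq_mul]
    ring
  obtain ⟨r, rfl⟩ := exists_eq_smul_of_minors hy0 ((hpar _ _ _ _ _ _ hu he₁).resolve_left hx1)
  obtain ⟨s, rfl⟩ := exists_eq_smul_of_minors hu0 ((hpar _ _ _ _ _ _ hu he₂).resolve_right hy2)
  have hr : r ≠ 0 := by
    rintro rfl
    exact h1 0 (by rw [he₁, zero_smul, tensorVec_zero, tensorVec_zero])
  have hs : s ≠ 0 := by
    rintro rfl
    exact h2 0 (by rw [he₂, zero_smul, zero_tensorVec, zero_tensorVec])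
  rcases hpar _ _ _ _ _ _ he₁ he₂ with h | h
  · refine hx1 fun i j => mul_left_cancel₀ hs ?_
    have := h i j
    simp only [Pi.smul_apply, smul_eq_mul] at this
    linear_combination -this
  · refine hy2 fun i j => mul_left_cancel₀ hr ?_
    have := h i j
    simp only [Pi.smul_apply, smul_eq_mul] at this
    linear_combination this

/-- The linear map `b ↦ V (a ⊗ b)`. -/
def partialMap {dA dB : ℕ} (V : Matrix (Fin dA × Fin dB) (Fin dA × Fin dB) ℂ) (a : Fin dA → ℂ) :
    (Fin dB → ℂ) →ₗ[ℂ] (Fin dA × Fin dB → ℂ) :=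
  V.mulVecLin ∘ₗ
    { toFun := fun b => tensorVec a b
      map_add' := fun b b' => by ext; simp [tensorVec, mul_add]
      map_smul' := fun r b => by ext; simp [tensorVec, mul_left_comm] }

lemma partialMap_apply {dA dB : ℕ} (V : Matrix (Fin dA × Fin dB) (Fin dA × Fin dB) ℂ)
    (a : Fin dA → ℂ) (b : Fin dB → ℂ) : partialMap V a b = V *ᵥ tensorVec a b := rfl

/-- The alternative of `common_factor_of_linear` for the families `b ↦ V (a ⊗ b)` falls on the
same side for every `a`. -/
lemma common_factor_uniform {dA dB : ℕ} (V : Matrix (Fin dA × Fin dB) (Fin dA × Fin dB) ℂ)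
    (hV : ∀ a b, ∃ x y, V *ᵥ tensorVec a b = tensorVec x y) :
    (∀ a, ∃ u, ∀ b, ∃ y, V *ᵥ tensorVec a b = tensorVec u y) ∨
      (∀ a, ∃ w, ∀ b, ∃ x, V *ᵥ tensorVec a b = tensorVec x w) := by
  have hRC := fun a => common_factor_of_linear (partialMap V a) (hV a)
  simp only [partialMap_apply] at hRC
  by_contra hne
  rw [not_or] at hne
  obtain ⟨⟨a', ha'⟩, a, ha⟩ := hne.imp not_forall.mp not_forall.mp
  obtain ⟨u, hu⟩ := (hRC a).resolve_right ha
  obtain ⟨w, hw⟩ := (hRC a').resolve_left ha'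
  choose β hβ using hu
  choose α hα using hw
  have hw0 : w ≠ 0 := by
    rintro rfl
    exact ha' ⟨0, fun b => ⟨0, by rw [hα b, tensorVec_zero, tensorVec_zero]⟩⟩
  have hu0 : u ≠ 0 := by
    rintro rfl
    exact ha ⟨0, fun b => ⟨0, by rw [hβ b, zero_tensorVec, zero_tensorVec]⟩⟩
  have hpar : ∀ b b', (∀ i j, u i * (α b + α b') j = u j * (α b + α b') i) ∨
      (∀ k l, (β b + β b') k * w l = (β b + β b') l * w k) := by
    intro b b'
    obtain ⟨x, y, hxy⟩ := hV (a + a') (b + b')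
    rw [add_tensorVec, mulVec_add, tensorVec_add, tensorVec_add, mulVec_add, mulVec_add, hβ, hβ,
      hα, hα, ← tensorVec_add, ← add_tensorVec] at hxy
    exact minors_eq_of_tensorVec_add hxy
  have h1 : ∃ b, ¬ ∀ k l, β b k * w l = β b l * w k := by
    by_contra! h
    refine ha ⟨w, fun b => ?_⟩
    obtain ⟨r, hr⟩ := exists_eq_smul_of_minors hw0 (x' := β b) fun k l => by
      linear_combination -(h b k l)
    refine ⟨r • u, ?_⟩
    rw [hβ, hr]
    ext p
    simp only [tensorVec, Pi.smul_apply, smul_eq_mul]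
    ring
  have h2 : ∃ b, ¬ ∀ i j, u i * α b j = u j * α b i := by
    by_contra! h
    refine ha' ⟨u, fun b => ?_⟩
    obtain ⟨r, hr⟩ := exists_eq_smul_of_minors hu0 (h b)
    refine ⟨r • w, ?_⟩
    rw [hα, hr]
    ext p
    simp only [tensorVec, Pi.smul_apply, smul_eq_mul]
    ring
  obtain ⟨b₁, h1⟩ := h1
  obtain ⟨b₂, h2⟩ := h2
  have h3 := (hpar b₁ b₁).resolve_right fun h => h1 fun k l => by
    have := h k l
    simp only [Pi.add_apply] at this
    linear_combination this / 2
  have h4 := (hpar b₂ b₂).resolve_left fun h => h2 fun k l => by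
    have := h k l
    simp only [Pi.add_apply] at this
    linear_combination this / 2
  rcases hpar b₁ b₂ with h | h
  · refine h2 fun i j => ?_
    have e1 := h i j
    have e2 := h3 i j
    simp only [Pi.add_apply] at e1 e2
    linear_combination e1 - e2 / 2
  · refine h1 fun i j => ?_
    have e1 := h i j
    have e2 := h4 i j
    simp only [Pi.add_apply] at e1 e2
    linear_combination e1 - e2 / 2

/-- If each family `b ↦ V (a ⊗ b)` has a common first factor, `V` is an elementary tensor. With
`V (e_i ⊗ b) = u_i ⊗ B_i b`, injectivity of `V` forbids `u_i` and `u_j` to be parallel, so `B_i b`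
and `B_j b` are parallel for all `b`, and the `B_i` are multiples of each other. -/
lemma exists_eq_kronecker_of_common_first_factor {dA dB : ℕ}
    (V : Matrix (Fin dA × Fin dB) (Fin dA × Fin dB) ℂ)
    (hV : ∀ a b, ∃ x y, V *ᵥ tensorVec a b = tensorVec x y)
    (hinj : Function.Injective V.mulVec) [Nonempty (Fin dA)] [Nonempty (Fin dB)]
    (hR : ∀ a, ∃ u, ∀ b, ∃ y, V *ᵥ tensorVec a b = tensorVec u y) :
    ∃ (A : Matrix (Fin dA) (Fin dA) ℂ) (B : Matrix (Fin dB) (Fin dB) ℂ), V = A ⊗ₖ B := by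
  have hne : ∀ (i : Fin dA) (b : Fin dB → ℂ), b ≠ 0 →
      tensorVec (Pi.single i (1 : ℂ)) b ≠ 0 := by
    intro i b hb h
    apply hb
    ext k
    simpa [tensorVec] using congrFun h (i, k)
  have hne' : ∀ (i : Fin dA) (b : Fin dB → ℂ), b ≠ 0 →
      V *ᵥ tensorVec (Pi.single i (1 : ℂ)) b ≠ 0 := by
    intro i b hb h
    exact hne i b hb (hinj (by rw [h, mulVec_zero]))
  -- On `e_i ⊗ ℂ^dB` the operator acts as `e_i ⊗ b ↦ u_i ⊗ B_i b`.
  have hcol : ∀ i : Fin dA, ∃ (u : Fin dA → ℂ) (B : Matrix (Fin dB) (Fin dB) ℂ), u ≠ 0 ∧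
      ∀ b, V *ᵥ tensorVec (Pi.single i 1) b = tensorVec u (B *ᵥ b) := by
    intro i
    obtain ⟨u, hu⟩ := hR (Pi.single i 1)
    have hu0 : u ≠ 0 := by
      rintro rfl
      obtain ⟨k⟩ := ‹Nonempty (Fin dB)›
      obtain ⟨y, hy⟩ := hu (Pi.single k 1)
      exact hne' i (Pi.single k 1) (by simp) (by rw [hy, zero_tensorVec])
    obtain ⟨p, hp⟩ := Function.ne_iff.mp hu0
    simp only [Pi.zero_apply] at hp
    refine ⟨u, Matrix.of fun k l => V (p, k) (i, l) / u p, hu0, fun b => ?_⟩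
    obtain ⟨y, hy⟩ := hu b
    rw [hy]
    congr 1
    ext k
    have := congrFun hy (p, k)
    simp only [mulVec, dotProduct, tensorVec, Fintype.sum_prod_type, Pi.single_apply, ite_mul,
      one_mul, zero_mul, mul_ite, mul_zero, Finset.sum_ite_irrel, Finset.sum_const_zero,
      Finset.sum_ite_eq', Finset.mem_univ, if_true] at this
    simp only [mulVec, dotProduct, of_apply, div_mul_eq_mul_div, ← Finset.sum_div]
    rw [this]
    field_simp
  choose u B hu0 hB using hcol
  have hBinj : ∀ i, Function.Injective (B i).mulVec := by
    intro i
    refine (injective_iff_map_eq_zero (B i).mulVecLin).mpr fun b hb => ?_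
    by_contra hb0
    apply hne' i b hb0
    rw [mulVecLin_apply] at hb
    rw [hB, hb, tensorVec_zero]
  have hBunit : ∀ i, IsUnit (B i) := fun i => mulVec_injective_iff_isUnit.mp (hBinj i)
  obtain ⟨i₀⟩ := ‹Nonempty (Fin dA)›
  have hscalar : ∀ j, ∃ z : ℂ, B j = z • B i₀ := by
    intro j
    by_cases hj : j = i₀
    · exact ⟨1, by rw [hj, one_smul]⟩
    have hdet : IsUnit (B i₀).det := (isUnit_iff_isUnit_det _).mp (hBunit i₀)
    have hupar : ¬ ∀ p q, u i₀ p * u j q = u i₀ q * u j p := by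
      intro h
      obtain ⟨r, hr⟩ := exists_eq_smul_of_minors (hu0 i₀) h
      obtain ⟨k⟩ := ‹Nonempty (Fin dB)›
      set b : Fin dB → ℂ := Pi.single k 1 with hb
      have : V *ᵥ tensorVec (Pi.single i₀ 1) ((B i₀)⁻¹ *ᵥ (r • (B j *ᵥ b))) =
          V *ᵥ tensorVec (Pi.single j 1) b := by
        rw [hB, hB, mulVec_mulVec, mul_nonsing_inv _ hdet, one_mulVec, hr]
        ext p
        simp only [tensorVec, Pi.smul_apply, smul_eq_mul]
        ring
      have := congrFun (hinj this) (j, k)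
      simp [tensorVec, hj, hb] at this
    have hpar : ∀ b, ∃ r : ℂ, B j *ᵥ b = r • (B i₀ *ᵥ b) := by
      intro b
      by_cases hb : b = 0
      · exact ⟨0, by simp [hb]⟩
      obtain ⟨x, y, hxy⟩ := hV (Pi.single i₀ 1 + Pi.single j 1) b
      rw [add_tensorVec, mulVec_add, hB, hB] at hxy
      refine exists_eq_smul_of_minors ?_ ((minors_eq_of_tensorVec_add hxy).resolve_left hupar)
      intro h0
      exact hb (hBinj i₀ (by rw [h0, mulVec_zero]))
    obtain ⟨z, hz⟩ := exists_eq_smul_one ((B i₀)⁻¹ * B j) fun c a hca => by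
      obtain ⟨r, hr⟩ := hpar a
      rw [← mulVec_mulVec, hr, mulVec_smul, mulVec_mulVec, nonsing_inv_mul _ hdet, one_mulVec,
        dotProduct_smul, hca, smul_zero]
    refine ⟨z, ?_⟩
    rw [← mul_nonsing_inv_cancel_left (B i₀) (B j) hdet, hz, Matrix.mul_smul, Matrix.mul_one]
  choose z hz using hscalar
  refine ⟨Matrix.of fun p i => z i * u i p, B i₀, ?_⟩
  ext ⟨p, k⟩ ⟨i, l⟩
  have := congrFun (hB i (Pi.single l 1)) (p, k)
  rw [tensorVec_single, hz i] at this
  simp only [mulVec_single_one, col_apply, tensorVec, Matrix.smul_apply, smul_eq_mul] at this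
  rw [this, kroneckerMap_apply, of_apply]
  ring

/-- The factors of a unitary elementary tensor can be rescaled to be unitary. -/
lemma mem_localUnitaries_of_eq_kronecker {dA dB : ℕ} [Nonempty (Fin dA)] [Nonempty (Fin dB)]
    (V : BipartiteUnitary dA dB) {A : Matrix (Fin dA) (Fin dA) ℂ} {B : Matrix (Fin dB) (Fin dB) ℂ}
    (h : V.1 = A ⊗ₖ B) : V ∈ localUnitaries dA dB := by
  have h1 : (Aᴴ * A) ⊗ₖ (Bᴴ * B) = 1 := by
    rw [mul_kronecker_mul, ← conjTranspose_kronecker, ← h]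
    exact mem_unitaryGroup_iff'.mp V.2
  obtain ⟨i₀⟩ := ‹Nonempty (Fin dA)›
  obtain ⟨k₀⟩ := ‹Nonempty (Fin dB)›
  set P := Aᴴ * A with hP
  set Q := Bᴴ * B with hQ
  have h2 : ∀ i j k l, P i j * Q k l = if (i = j ∧ k = l) then 1 else 0 := by
    intro i j k l
    have := congrFun₂ h1 (i, k) (j, l)
    simpa [kroneckerMap_apply, one_apply] using this
  have h00 : P i₀ i₀ * Q k₀ k₀ = 1 := by simpa using h2 i₀ i₀ k₀ k₀
  obtain ⟨c, hc, hPc⟩ : ∃ c : ℝ, 0 < c ∧ P i₀ i₀ = (c : ℂ) := by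
    have h0 : 0 ≤ P i₀ i₀ := (posSemidef_conjTranspose_mul_self A).diag_nonneg
    obtain ⟨c, hc0, hc⟩ := RCLike.nonneg_iff_exists_ofReal.mp h0
    refine ⟨c, lt_of_le_of_ne hc0 fun h => ?_, hc.symm⟩
    rw [← hc, ← h] at h00
    simp at h00
  have hcc : (c : ℂ) ≠ 0 := by exact_mod_cast hc.ne'
  have hQc : Q k₀ k₀ = (c : ℂ)⁻¹ := by
    rw [hPc] at h00
    exact eq_inv_of_mul_eq_one_right h00
  have hPeq : P = (c : ℂ) • 1 := by
    ext i j
    have := h2 i j k₀ k₀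
    simp only [hQc, and_true] at this
    rw [Matrix.smul_apply, one_apply, smul_eq_mul, ← this]
    field_simp
  have hQeq : Q = (c : ℂ)⁻¹ • 1 := by
    ext k l
    have := h2 i₀ i₀ k l
    simp only [hPc, true_and] at this
    rw [Matrix.smul_apply, one_apply, smul_eq_mul, ← this]
    field_simp
  have hs : ((Real.sqrt c : ℝ) : ℂ) * (Real.sqrt c : ℝ) = c := by
    rw [← Complex.ofReal_mul, Real.mul_self_sqrt hc.le]
  have hs0 : ((Real.sqrt c : ℝ) : ℂ) ≠ 0 := by
    exact_mod_cast (Real.sqrt_pos.mpr hc).ne'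
  refine ⟨⟨((Real.sqrt c : ℝ) : ℂ)⁻¹ • A, ?_⟩, ⟨((Real.sqrt c : ℝ) : ℂ) • B, ?_⟩, ?_⟩
  · rw [mem_unitaryGroup_iff', star_eq_conjTranspose, conjTranspose_smul, Matrix.smul_mul,
      Matrix.mul_smul, ← hP, hPeq, smul_smul, smul_smul, ← hs]
    simp only [Complex.star_def, map_inv₀, Complex.conj_ofReal]
    field_simp
    rw [one_smul]
  · rw [mem_unitaryGroup_iff', star_eq_conjTranspose, conjTranspose_smul, Matrix.smul_mul,
      Matrix.mul_smul, ← hQ, hQeq, smul_smul, smul_smul, ← hs]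
    simp only [Complex.star_def, Complex.conj_ofReal]
    field_simp
    rw [one_smul]
  · rw [h, smul_kronecker, kronecker_smul, smul_smul, inv_mul_cancel₀ hs0, one_smul]

lemma swapMatrix_mulVec {d : ℕ} (ψ : Fin d × Fin d → ℂ) (p : Fin d × Fin d) :
    (swapMatrix rfl *ᵥ ψ) p = ψ p.swap := by
  obtain ⟨i, k⟩ := p
  simp only [mulVec, dotProduct, swapMatrix, of_apply, Fin.cast_eq_self]
  rw [Finset.sum_eq_single (k, i)]
  · simp
  · rintro ⟨i', k'⟩ - h
    rw [if_neg, zero_mul]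
    rintro ⟨h1, h2⟩
    exact h (by simp_all)
  · simp

lemma swapMatrix_mulVec_tensorVec {d : ℕ} (a b : Fin d → ℂ) :
    swapMatrix rfl *ᵥ tensorVec a b = tensorVec b a := by
  ext p
  rw [swapMatrix_mulVec]
  simp [tensorVec, mul_comm]

lemma swapMatrix_mul_self {d : ℕ} : swapMatrix (rfl : d = d) * swapMatrix (rfl : d = d) = 1 := by
  apply ext_of_mulVec_single
  intro p
  ext q
  rw [← mulVec_mulVec, swapMatrix_mulVec, swapMatrix_mulVec, Prod.swap_swap, one_mulVec]

lemma swapMatrix_conjTranspose {d : ℕ} :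
    (swapMatrix (rfl : d = d))ᴴ = swapMatrix (rfl : d = d) := by
  ext p q
  simp only [conjTranspose_apply, swapMatrix, of_apply, Fin.cast_eq_self]
  by_cases h : q.1 = p.2 ∧ q.2 = p.1
  · rw [if_pos h, if_pos ⟨h.2.symm, h.1.symm⟩, star_one]
  · rw [if_neg h, if_neg (fun h' => h ⟨h'.2.symm, h'.1.symm⟩), star_zero]

lemma submatrix_swap_mulVec {dA dB : ℕ} (V : Matrix (Fin dA × Fin dB) (Fin dA × Fin dB) ℂ)
    (a : Fin dA → ℂ) (b : Fin dB → ℂ) (p : Fin dB × Fin dA) :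
    (V.submatrix Prod.swap Prod.swap *ᵥ tensorVec b a) p = (V *ᵥ tensorVec a b) p.swap := by
  simp only [mulVec, dotProduct, submatrix_apply, Fintype.sum_prod_type, tensorVec]
  rw [Finset.sum_comm]
  exact Finset.sum_congr rfl fun _ _ => Finset.sum_congr rfl fun _ _ => by simp [mul_comm]

/-- If the vectors `V (a ⊗ b)` with fixed `a` share a second factor, `b` is recovered from the first
factor, which bounds `dB` by `dA`. -/
lemma le_of_common_second_factor {dA dB : ℕ}
    (V : Matrix (Fin dA × Fin dB) (Fin dA × Fin dB) ℂ) [Nonempty (Fin dA)]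
    (hinj : Function.Injective V.mulVec)
    (hC : ∀ a, ∃ w, ∀ b, ∃ x, V *ᵥ tensorVec a b = tensorVec x w) : dB ≤ dA := by
  obtain ⟨i⟩ := ‹Nonempty (Fin dA)›
  obtain ⟨w, hw⟩ := hC (Pi.single i 1)
  by_cases hw0 : w = 0
  · by_contra hlt
    have : tensorVec (Pi.single i (1 : ℂ)) (Pi.single (⟨0, by omega⟩ : Fin dB) 1) = 0 := by
      apply hinj
      obtain ⟨x, hx⟩ := hw (Pi.single (⟨0, by omega⟩ : Fin dB) 1)
      rw [hx, hw0, tensorVec_zero, mulVec_zero]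
    rw [tensorVec_single] at this
    simp at this
  obtain ⟨q, hq⟩ := Function.ne_iff.mp hw0
  simp only [Pi.zero_apply] at hq
  set L : (Fin dB → ℂ) →ₗ[ℂ] (Fin dA → ℂ) :=
    LinearMap.funLeft ℂ ℂ (fun p => (p, q)) ∘ₗ partialMap V (Pi.single i 1) with hL
  have hLinj : Function.Injective L := by
    refine (injective_iff_map_eq_zero L).mpr fun b hb => ?_
    obtain ⟨x, hx⟩ := hw b
    have hx0 : x = 0 := by
      ext p
      have := congrFun hb p
      simp only [hL, LinearMap.comp_apply, LinearMap.funLeft_apply, partialMap_apply, hx,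
        tensorVec, Pi.zero_apply, mul_eq_zero, hq, or_false] at this
      exact this
    rw [hx0, zero_tensorVec, ← mulVec_zero V] at hx
    ext k
    simpa [tensorVec] using congrFun (hinj hx) (i, k)
  simpa using LinearMap.finrank_le_finrank_of_injective hLinj

/-- A unitary mapping product vectors to product vectors is local up to a swap. -/
lemma mem_local_or_swapLocal {dA dB : ℕ} (V : BipartiteUnitary dA dB) (hV : ¬ IsImprimitive V) :
    V ∈ localUnitaries dA dB ∨ V ∈ swapLocalUnitaries dA dB := by
  have hprod : ∀ a b, ∃ x y, V.1 *ᵥ tensorVec a b = tensorVec x y := by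
    intro a b
    by_contra h
    exact hV ⟨a, b, h⟩
  have hVV : V.1ᴴ * V.1 = 1 := mem_unitaryGroup_iff'.mp V.2
  have hinj : Function.Injective V.1.mulVec := by
    intro ψ φ h
    have := congrArg (V.1ᴴ *ᵥ ·) h
    simpa [hVV] using this
  rcases isEmpty_or_nonempty (Fin dA) with hA | hA
  · exact Or.inl ⟨1, 1, Subsingleton.elim _ _⟩
  rcases isEmpty_or_nonempty (Fin dB) with hB | hB
  · exact Or.inl ⟨1, 1, Subsingleton.elim _ _⟩
  rcases common_factor_uniform V.1 hprod with hR | hC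
  · obtain ⟨A, B, h⟩ := exists_eq_kronecker_of_common_first_factor V.1 hprod hinj hR
    exact Or.inl (mem_localUnitaries_of_eq_kronecker V h)
  -- The same alternative with the roles of the two tensor factors exchanged.
  set V' : Matrix (Fin dB × Fin dA) (Fin dB × Fin dA) ℂ := V.1.submatrix Prod.swap Prod.swap
    with hV'
  have hprod' : ∀ b a, ∃ y x, V' *ᵥ tensorVec b a = tensorVec y x := by
    intro b a
    obtain ⟨x, y, h⟩ := hprod a b
    refine ⟨y, x, ?_⟩
    ext p
    rw [hV', submatrix_swap_mulVec, h]
    simp [tensorVec, mul_comm]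
  have hinj' : Function.Injective V'.mulVec := by
    have h1 : V'ᴴ * V' = 1 := by
      rw [hV', conjTranspose_submatrix]
      have := submatrix_mul_equiv V.1ᴴ V.1 Prod.swap (Equiv.prodComm (Fin dB) (Fin dA)) Prod.swap
      rw [Equiv.coe_prodComm] at this
      rw [this, hVV]
      exact submatrix_one_equiv (Equiv.prodComm (Fin dB) (Fin dA))
    intro ψ φ h
    have := congrArg (V'ᴴ *ᵥ ·) h
    simpa [h1] using this
  rcases common_factor_uniform V' hprod' with hR' | hC'
  · obtain ⟨B, A, h⟩ := exists_eq_kronecker_of_common_first_factor V' hprod' hinj' hR'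
    refine Or.inl (mem_localUnitaries_of_eq_kronecker V (A := A) (B := B) ?_)
    ext p q
    have := congrFun₂ h p.swap q.swap
    simpa [hV', kroneckerMap_apply, mul_comm] using this
  -- In the remaining case, up to scale, the first factor of `V (a ⊗ b)` depends only on `b` and the
  -- second only on `a`; composing with the swap leads back to the case of a common first factor.
  obtain rfl : dA = dB := le_antisymm (le_of_common_second_factor V' hinj' hC')
    (le_of_common_second_factor V.1 hinj hC)
  right
  have hS : swapMatrix (rfl : dA = dA) ∈ Matrix.unitaryGroup (Fin dA × Fin dA) ℂ := by
    rw [mem_unitaryGroup_iff', star_eq_conjTranspose, swapMatrix_conjTranspose,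
      swapMatrix_mul_self]
  set W : BipartiteUnitary dA dA := ⟨swapMatrix rfl, hS⟩ * V with hW
  have hW1 : W.1 = swapMatrix rfl * V.1 := rfl
  have hWinj : Function.Injective W.1.mulVec := by
    intro ψ φ h
    have h1 : W.1ᴴ * W.1 = 1 := mem_unitaryGroup_iff'.mp W.2
    have := congrArg (W.1ᴴ *ᵥ ·) h
    simpa [h1] using this
  have hWV : ∀ a b x y, V.1 *ᵥ tensorVec a b = tensorVec x y →
      W.1 *ᵥ tensorVec a b = tensorVec y x := by
    intro a b x y h
    rw [hW1, ← mulVec_mulVec, h, swapMatrix_mulVec_tensorVec]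
  obtain ⟨A, B, h⟩ := exists_eq_kronecker_of_common_first_factor W.1
    (fun a b => by
      obtain ⟨x, y, h⟩ := hprod a b
      exact ⟨y, x, hWV _ _ _ _ h⟩) hWinj
    (fun a => by
      obtain ⟨w, hw⟩ := hC a
      refine ⟨w, fun b => ?_⟩
      obtain ⟨x, hx⟩ := hw b
      exact ⟨x, hWV _ _ _ _ hx⟩)
  obtain ⟨UA, UB, hU⟩ := mem_localUnitaries_of_eq_kronecker W h
  refine ⟨rfl, UA, UB, ?_⟩
  rw [← hU, hW1, ← Matrix.mul_assoc, swapMatrix_mul_self, Matrix.one_mul]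

lemma isImprimitive_iff {dA dB : ℕ} (V : BipartiteUnitary dA dB) :
    IsImprimitive V ↔ V ∉ localUnitaries dA dB ∧ V ∉ swapLocalUnitaries dA dB := by
  constructor
  · rintro ⟨a, b, hab⟩
    constructor
    · rintro ⟨UA, UB, h⟩
      exact hab ⟨UA.1 *ᵥ a, UB.1 *ᵥ b, by rw [h, kronecker_mulVec_tensorVec]⟩
    · rintro ⟨rfl, UA, UB, h⟩
      exact hab ⟨UB.1 *ᵥ b, UA.1 *ᵥ a, by
        rw [h, ← mulVec_mulVec, kronecker_mulVec_tensorVec, swapMatrix_mulVec_tensorVec]⟩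
  · rintro ⟨h1, h2⟩
    by_contra h
    exact (mem_local_or_swapLocal V h).elim h1 h2

end BipartiteGates

namespace BipartiteGates

/-! ### Words in subsets of the unitary group of a C⋆-algebra -/

section UnitaryWords

variable {A : Type*} [CStarAlgebra A]

open Filter Topology

/-- A real subspace `D` of a C⋆-algebra is reachable at `P` if some map into the unitary group
through `1`, whose right translate by `P` takes values in words of a fixed length `L` in `S`,
has `D` as the range of its derivative. -/
def IsReachable (S : Set (unitary A)) (D : Submodule ℝ A) (P : unitary A) : Prop :=
  ∃ (E : Type) (_ : NormedAddCommGroup E) (_ : NormedSpace ℝ E) (_ : CompleteSpace E) (L : ℕ)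
    (Ψ : E → unitary A) (Ψ' : E →L[ℝ] A), (∀ x, Ψ x * P ∈ S ^ L) ∧ Ψ 0 = 1 ∧
      HasStrictFDerivAt (fun x => (Ψ x : A)) Ψ' 0 ∧ LinearMap.range (Ψ' : E →ₗ[ℝ] A) = D

/-- Conjugation by a unitary, as a real continuous linear map. -/
noncomputable def conjCLM (P : unitary A) : A →L[ℝ] A :=
  ContinuousLinearMap.mulLeftRight ℝ A (P : A) (star (P : A))

lemma conjCLM_apply (P : unitary A) (x : A) : conjCLM P x = P * x * star (P : A) := rfl

lemma conjCLM_injective (P : unitary A) : Function.Injective (conjCLM P) := by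
  intro x y h
  have hP : star (P : A) * P = 1 := Unitary.coe_star_mul_self P
  have hc : ∀ z, star (P : A) * conjCLM P z * P = z := fun z => by
    rw [conjCLM_apply, mul_assoc, mul_assoc, mul_assoc, hP, mul_one, ← mul_assoc, hP, one_mul]
  rw [← hc x, h, hc]

/-- Directions reached by two words are reached by their concatenation, those of the second word
being conjugated by the first. -/
lemma IsReachable.mul {S : Set (unitary A)} {D₁ D₂ : Submodule ℝ A} {P₁ P₂ : unitary A}
    (h₁ : IsReachable S D₁ P₁) (h₂ : IsReachable S D₂ P₂) :
    IsReachable S (D₁ ⊔ D₂.map (conjCLM P₁ : A →ₗ[ℝ] A)) (P₁ * P₂) := by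
  obtain ⟨E₁, _, _, _, L₁, Ψ₁, Ψ₁', hS₁, h0₁, hd₁, hr₁⟩ := h₁
  obtain ⟨E₂, _, _, _, L₂, Ψ₂, Ψ₂', hS₂, h0₂, hd₂, hr₂⟩ := h₂
  refine ⟨E₁ × E₂, inferInstance, inferInstance, inferInstance, L₁ + L₂,
    fun x => Ψ₁ x.1 * (P₁ * Ψ₂ x.2 * P₁⁻¹), Ψ₁'.coprod (conjCLM P₁ ∘L Ψ₂'), ?_, ?_, ?_, ?_⟩
  · intro x
    rw [pow_add]
    refine Set.mem_mul.mpr ⟨_, hS₁ x.1, _, hS₂ x.2, ?_⟩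
    group
  · simp [h0₁, h0₂]
  · have hf : HasStrictFDerivAt (fun x : E₁ × E₂ => (Ψ₁ x.1 : A))
        (Ψ₁' ∘L ContinuousLinearMap.fst ℝ E₁ E₂) 0 :=
      HasStrictFDerivAt.comp (g := fun x => (Ψ₁ x : A)) (0 : E₁ × E₂) hd₁ hasStrictFDerivAt_fst
    have hg : HasStrictFDerivAt (fun x : E₁ × E₂ => conjCLM P₁ (Ψ₂ x.2 : A))
        (conjCLM P₁ ∘L (Ψ₂' ∘L ContinuousLinearMap.snd ℝ E₁ E₂)) 0 :=
      (conjCLM P₁).hasStrictFDerivAt.comp (0 : E₁ × E₂)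
        (HasStrictFDerivAt.comp (g := fun x => (Ψ₂ x : A)) (0 : E₁ × E₂) hd₂ hasStrictFDerivAt_snd)
    refine (hf.mul' hg).congr_fderiv ?_
    refine ContinuousLinearMap.ext fun x => ?_
    simp [h0₁, h0₂, conjCLM_apply, add_comm]
  · rw [ContinuousLinearMap.coe_coprod, LinearMap.range_coprod, hr₁,
      ContinuousLinearMap.toLinearMap_comp, LinearMap.range_comp, hr₂]

lemma isReachable_bot {S : Set (unitary A)} {U : unitary A} (hU : U ∈ S) :
    IsReachable S ⊥ U :=
  ⟨ℝ, inferInstance, inferInstance, inferInstance, 1, fun _ => 1, 0, by simpa using hU, rfl,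
    hasStrictFDerivAt_const _ _, by simp⟩

open selfAdjoint in
lemma isReachable_span {S : Set (unitary A)} {x : selfAdjoint A}
    (hx : ∀ t : ℝ, expUnitary (t • x) ∈ S) :
    IsReachable S (Submodule.span ℝ {Complex.I • (x : A)}) 1 := by
  refine ⟨ℝ, inferInstance, inferInstance, inferInstance, 1, fun t => expUnitary (t • x),
    ContinuousLinearMap.toSpanSingleton ℝ (Complex.I • (x : A)), by simpa using hx, by simp, ?_, ?_⟩
  · have := (hasStrictDerivAt_exp_smul_const (𝕂 := ℝ) (Complex.I • (x : A)) 0).hasStrictFDerivAt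
    have hf : (fun t : ℝ => (expUnitary (t • x) : A)) =
        fun t => NormedSpace.exp (t • Complex.I • (x : A)) := by
      funext t
      rw [expUnitary_coe]
      congr 1
      exact smul_comm _ _ _
    rw [hf]
    refine this.congr_fderiv (ContinuousLinearMap.ext fun t => ?_)
    simp
  · ext y
    simp [Submodule.mem_span_singleton]

/-- There is a largest reachable subspace. It contains the direction of every one-parameter group
in `S` and is invariant under conjugation by `S`: a maximal reachable `D`, reached at `P`, absorbs
`P D' P⁻¹` for every reachable `D'`, in particular `P D P⁻¹ = D`. -/
lemma exists_isReachable_maximal [FiniteDimensional ℂ A] (S : Set (unitary A))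
    (h1 : (1 : unitary A) ∈ S) :
    ∃ (D : Submodule ℝ A) (P : unitary A), IsReachable S D P ∧
      (∀ x : selfAdjoint A, (∀ t : ℝ, selfAdjoint.expUnitary (t • x) ∈ S) →
        Complex.I • (x : A) ∈ D) ∧
      ∀ U ∈ S, ∀ d ∈ D, (U : A) * d * star (U : A) ∈ D := by
  have : FiniteDimensional ℝ A := FiniteDimensional.complexToReal A
  obtain ⟨D, ⟨P, hP⟩, hmax⟩ := (wellFounded_gt (α := Submodule ℝ A)).has_min
    {D | ∃ P, IsReachable S D P} ⟨⊥, 1, isReachable_bot h1⟩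
  have habs : ∀ D' P', IsReachable S D' P' → D'.map (conjCLM P : A →ₗ[ℝ] A) ≤ D := by
    intro D' P' h'
    have h := hmax _ ⟨_, hP.mul h'⟩
    rw [lt_iff_le_not_ge, not_and_not_right] at h
    exact le_sup_right.trans (h le_sup_left)
  have hD : D.map (conjCLM P : A →ₗ[ℝ] A) = D :=
    Submodule.eq_of_le_of_finrank_eq (habs D P hP)
      (Submodule.equivMapOfInjective (conjCLM P : A →ₗ[ℝ] A)
        (conjCLM_injective P) D).finrank_eq.symm
  have hall : ∀ D' P', IsReachable S D' P' → D' ≤ D := by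
    intro D' P' h' d hd
    have h2 : conjCLM P d ∈ D.map (conjCLM P : A →ₗ[ℝ] A) := by
      rw [hD]
      exact habs D' P' h' (Submodule.mem_map_of_mem hd)
    obtain ⟨e, he, hed⟩ := h2
    rwa [← conjCLM_injective P hed]
  refine ⟨D, P, hP, fun x hx => ?_, fun U hU d hd => ?_⟩
  · exact hall _ _ (isReachable_span hx) (Submodule.mem_span_singleton_self _)
  · exact hall _ _ ((isReachable_bot hU).mul hP)
      (le_sup_right (a := (⊥ : Submodule ℝ A)) (Submodule.mem_map_of_mem hd))

/-- Near `1`, a unitary is determined by its skew-adjoint part `(u - u⋆) / 2`: its selfadjoint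
part is a square root, close to `1`, of `1 + ((u - u⋆) / 2)²`. -/
lemma unitary_eq_of_sub_star_eq {u v : A} (hu : u ∈ unitary A) (hv : v ∈ unitary A)
    (hu1 : ‖u - 1‖ < 1) (hv1 : ‖v - 1‖ < 1) (h : u - star u = v - star v) : u = v := by
  -- Since `u` is normal, `(u + u⋆)² - (u - u⋆)² = 2 (u u⋆ + u⋆ u) = 4`.
  have hsq : ∀ w ∈ unitary A, (w + star w) * (w + star w) =
      (w - star w) * (w - star w) + 4 := by
    intro w hw
    have e1 := Unitary.mul_star_self_of_mem hw
    have e2 := Unitary.star_mul_self_of_mem hw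
    have : (w + star w) * (w + star w) - (w - star w) * (w - star w) =
        2 * (w * star w) + 2 * (star w * w) := by noncomm_ring
    rw [e1, e2] at this
    rw [← sub_eq_iff_eq_add', this]
    norm_num
  set C := u + star u with hC
  set C' := v + star v with hC'
  have hCC : C * C = C' * C' := by rw [hsq u hu, hsq v hv, h]
  set F := (u - 1) + star (u - 1) + ((v - 1) + star (v - 1)) with hF
  have hFC : C + C' = 4 + F := by
    simp only [hF, hC, hC', star_sub, star_one]
    have : (4 : A) = 1 + 1 + 1 + 1 := by norm_num
    rw [this]
    abel
  have hFn : ‖F‖ < 4 := by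
    calc ‖F‖ ≤ ‖u - 1‖ + ‖star (u - 1)‖ + (‖v - 1‖ + ‖star (v - 1)‖) :=
          (norm_add_le _ _).trans (add_le_add (norm_add_le _ _) (norm_add_le _ _))
      _ < 4 := by rw [norm_star, norm_star]; linarith
  -- `C² = C'²` gives `(C - C') (C + C') + (C + C') (C - C') = 0`, and `C + C'` is close to `4`.
  have hD : (8 : ℝ) • (C - C') = -((C - C') * F + F * (C - C')) := by
    have h0 : (C - C') * (C + C') + (C + C') * (C - C') = 0 := by
      have : (C - C') * (C + C') + (C + C') * (C - C') = 2 * (C * C) - 2 * (C' * C') := by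
        noncomm_ring
      rw [this, hCC, sub_self]
    rw [hFC, mul_add, add_mul] at h0
    have h8 : (8 : ℝ) • (C - C') = (C - C') * 4 + 4 * (C - C') := by
      rw [show (8 : ℝ) = ((8 : ℕ) : ℝ) by norm_num, Nat.cast_smul_eq_nsmul]
      noncomm_ring
    rw [h8, eq_neg_iff_add_eq_zero, ← h0]
    abel
  have hCeq : C - C' = 0 := by
    by_contra hne
    have hpos : 0 < ‖C - C'‖ := norm_pos_iff.mpr hne
    have hn := congrArg norm hD
    rw [norm_smul, norm_neg] at hn
    have h3 : ‖(C - C') * F + F * (C - C')‖ ≤ ‖C - C'‖ * ‖F‖ + ‖F‖ * ‖C - C'‖ :=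
      (norm_add_le _ _).trans (add_le_add (norm_mul_le _ _) (norm_mul_le _ _))
    norm_num at hn
    nlinarith
  have h2 : (2 : ℝ) • u = (2 : ℝ) • v := by
    rw [two_smul, two_smul]
    have e1 : u + u = C + (u - star u) := by rw [hC]; abel
    have e2 : v + v = C' + (v - star v) := by rw [hC']; abel
    rw [e1, e2, h, sub_eq_zero.mp hCeq]
  exact smul_right_injective A (two_ne_zero' ℝ) h2

/-- If every skew-adjoint direction is reachable at `P`, words of a fixed length fill a
neighbourhood of `P` in the unitary group: the map `x ↦ Ψ x - (Ψ x)⋆` is a submersion onto the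
skew-adjoint elements, and its value determines `Ψ x`. -/
lemma IsReachable.exists_nhds_subset [FiniteDimensional ℂ A] {S : Set (unitary A)}
    {D : Submodule ℝ A} {P : unitary A}
    (h : IsReachable S D P) (hD : ∀ d, star d = -d → d ∈ D) :
    ∃ L : ℕ, ∀ᶠ W in 𝓝 (1 : unitary A), W * P ∈ S ^ L := by
  have : FiniteDimensional ℝ A := FiniteDimensional.complexToReal A
  obtain ⟨E, _, _, _, L, Ψ, Ψ', hS, h0, hd, hr⟩ := h
  refine ⟨L, ?_⟩
  set F : Submodule ℝ A := skewAdjoint.submodule ℝ A with hF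
  have hmem : ∀ x : A, x - star x ∈ F := by
    intro x
    change star (x - star x) = -(x - star x)
    simp
  set π₀ : A →ₗ[ℝ] F := LinearMap.codRestrict F
    { toFun := fun x => x - star x
      map_add' := fun x y => by simp only [star_add]; abel
      map_smul' := fun r x => by simp [smul_sub] } hmem with hπ₀
  set π : A →L[ℝ] F := LinearMap.toContinuousLinearMap π₀ with hπ
  have hπ_apply : ∀ x, (π x : A) = x - star x := fun x => rfl
  have hcomp : HasStrictFDerivAt (fun x => π (Ψ x : A)) (π ∘L Ψ') 0 :=
    π.hasStrictFDerivAt.comp (0 : E) hd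
  have hsurj : LinearMap.range (π ∘L Ψ' : E →L[ℝ] F).toLinearMap = ⊤ := by
    rw [LinearMap.range_eq_top]
    rintro ⟨f, hf⟩
    have hf' : star f = -f := hf
    have hf2 : (1 / 2 : ℝ) • f ∈ D := hD _ (by rw [star_smul, hf', smul_neg]; simp)
    rw [← hr] at hf2
    obtain ⟨x, hx⟩ := hf2
    refine ⟨x, Subtype.ext ?_⟩
    change Ψ' x - star (Ψ' x) = f
    change Ψ' x = _ at hx
    rw [hx, star_smul, hf', smul_neg, sub_neg_eq_add, star_trivial, ← add_smul]
    norm_num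
  have hmap := hcomp.map_nhds_eq_of_surj hsurj
  have hcont : ContinuousAt (fun x => (Ψ x : A)) 0 := hd.continuousAt
  have hnear : ∀ᶠ x in 𝓝 (0 : E), ‖(Ψ x : A) - 1‖ < 1 := by
    have : Tendsto (fun x => ‖(Ψ x : A) - 1‖) (𝓝 0) (𝓝 ‖(Ψ 0 : A) - 1‖) :=
      (hcont.sub continuousAt_const).norm
    rw [h0] at this
    exact this.eventually_lt_const (by simp)
  have himg : ∀ᶠ f in 𝓝 (π (Ψ 0 : A)), ∃ x, ‖(Ψ x : A) - 1‖ < 1 ∧ π (Ψ x : A) = f := by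
    rw [← hmap]
    exact eventually_map.mpr (hnear.mono fun x hx => ⟨x, hx, rfl⟩)
  rw [h0] at himg
  have hW1 : ∀ᶠ W : unitary A in 𝓝 1, ‖(W : A) - 1‖ < 1 := by
    have : Tendsto (fun W : unitary A => ‖(W : A) - 1‖) (𝓝 1) (𝓝 ‖((1 : unitary A) : A) - 1‖) :=
      ((continuous_subtype_val.sub continuous_const).norm).tendsto 1
    exact this.eventually_lt_const (by simp)
  have hW2 := ((π.continuous.comp continuous_subtype_val).tendsto (1 : unitary A)).eventually himg
  filter_upwards [hW1, hW2] with W hW1 ⟨x, hx1, hx2⟩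
  have : Ψ x = W := Subtype.ext (unitary_eq_of_sub_star_eq (Ψ x).2 W.2 hx1 hW1
    (congrArg Subtype.val hx2))
  rw [← this]
  exact hS x

lemma compactSpace_unitary [FiniteDimensional ℂ A] : CompactSpace (unitary A) := by
  have : ProperSpace A := FiniteDimensional.proper ℂ A
  refine isCompact_iff_compactSpace.mp (Metric.isCompact_of_isClosed_isBounded ?_ ?_)
  · have : (unitary A : Set A) = {x | star x * x = 1} ∩ {x | x * star x = 1} := rfl
    rw [this]
    exact (isClosed_eq (by fun_prop) continuous_const).inter
      (isClosed_eq (by fun_prop) continuous_const)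
  · refine (Metric.isBounded_closedBall (x := (0 : A)) (r := 1)).subset fun u hu => ?_
    rw [mem_closedBall_zero_iff]
    rcases subsingleton_or_nontrivial A with _ | _
    · simp [Subsingleton.elim u 0]
    · exact (CStarRing.norm_of_mem_unitary hu).le

/-- Words filling a neighbourhood of some `P` give words filling a neighbourhood of `1`, because
in a compact group `P⁻¹` is a limit of positive powers of `P`. -/
lemma exists_nhds_one_subset [FiniteDimensional ℂ A] {S : Set (unitary A)} {P : unitary A} {L : ℕ}
    (h : ∀ᶠ W in 𝓝 (1 : unitary A), W * P ∈ S ^ L) :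
    ∃ L' : ℕ, ∀ᶠ W in 𝓝 (1 : unitary A), W ∈ S ^ L' := by
  have := compactSpace_unitary (A := A)
  have hP : P ∈ S ^ L := by simpa using h.self_of_nhds
  have hcl : MapClusterPt P⁻¹ atTop (P ^ · : ℕ → unitary A) := by
    simpa using mapClusterPt_self_zpow_atTop_pow P (-1)
  have hc : Tendsto (fun g : unitary A => (g * P)⁻¹) (𝓝 P⁻¹) (𝓝 1) := by
    have : Continuous (fun g : unitary A => (g * P)⁻¹) := by fun_prop
    simpa using this.tendsto P⁻¹
  -- `k` is chosen so that `P ^ (k + 1)` is close enough to `1`.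
  obtain ⟨k, hk⟩ := (hcl.frequently (hc.eventually h.eventually_nhds)).exists
  refine ⟨L + L * k, ?_⟩
  have hc2 : Tendsto (fun W : unitary A => W * (P ^ k * P)⁻¹) (𝓝 1) (𝓝 (P ^ k * P)⁻¹) := by
    have : Continuous (fun W : unitary A => W * (P ^ k * P)⁻¹) := by fun_prop
    simpa using this.tendsto 1
  filter_upwards [hc2.eventually hk] with W hW
  rw [pow_add, pow_mul]
  refine Set.mem_mul.mpr ⟨_, hW, _, Set.pow_mem_pow hP (n := k), ?_⟩
  rw [← pow_succ, pow_succ']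
  group

lemma finite_spectrum_of_finiteDimensional [FiniteDimensional ℂ A] (a : A) :
    (spectrum ℂ a).Finite := by
  refine ((minpoly ℂ a).roots.toFinset.finite_toSet).subset fun z hz => ?_
  -- Spectral values are roots of the minimal polynomial.
  have h := spectrum.subset_polynomial_aeval a (minpoly ℂ a) ⟨z, hz, rfl⟩
  rw [minpoly.aeval] at h
  rcases subsingleton_or_nontrivial A with _ | _
  · simp [spectrum.of_subsingleton] at hz
  rw [spectrum.zero_eq, Set.mem_singleton_iff] at h
  have hint : IsIntegral ℂ a := IsIntegral.of_finite ℂ a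
  simpa [Polynomial.mem_roots (minpoly.ne_zero hint)] using h

open selfAdjoint in
/-- A unitary element of a finite-dimensional C⋆-algebra becomes an exponential after multiplication
by a phase that moves `-1` off its spectrum. -/
lemma exists_eq_expUnitary_mul [FiniteDimensional ℂ A] (W : unitary A) :
    ∃ x y : selfAdjoint A, W = expUnitary x * expUnitary y := by
  obtain ⟨z, hz⟩ : ∃ z : Circle, ((-z : ℂ)) ∉ spectrum ℂ (W : A) := by
    have : Infinite (Set.Ioc (-Real.pi) Real.pi) :=
      (Set.Ioc_infinite (by linarith [Real.pi_pos])).to_subtype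
    have : Infinite Circle := Infinite.of_injective _ Circle.argEquiv.symm.injective
    have hinf : (Set.range fun z : Circle => -(z : ℂ)).Infinite := by
      refine Set.infinite_range_of_injective fun z w h => ?_
      exact Circle.ext (neg_injective h)
    obtain ⟨_, ⟨z, rfl⟩, hz⟩ := hinf.exists_notMem_finite
      (finite_spectrum_of_finiteDimensional (W : A))
    exact ⟨z, hz⟩
  set x : selfAdjoint A := (Complex.arg z : ℝ) • 1 with hx
  have hxe : (expUnitary x : A) = algebraMap ℂ A z := by
    have : Complex.I • (x : A) = algebraMap ℂ A (Complex.arg z * Complex.I) := by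
      rw [hx, Algebra.algebraMap_eq_smul_one, mul_comm, mul_smul]
      simp
    rw [expUnitary_coe, this, ← NormedSpace.algebraMap_exp_comm, ← Complex.exp_eq_exp_ℂ]
    congr 1
    conv_rhs => rw [← Circle.exp_arg z]
    rw [Circle.coe_exp]
  have hnorm : ‖(((expUnitary x)⁻¹ * W : unitary A) - 1 : A)‖ < 2 := by
    rw [Unitary.norm_sub_one_lt_two_iff ((expUnitary x)⁻¹ * W : unitary A).2]
    intro hmem
    apply hz
    have hWe : (W : A) = (z : ℂ) • (((expUnitary x)⁻¹ * W : unitary A) : A) := by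
      rw [Algebra.smul_def, ← hxe, ← Submonoid.coe_mul, mul_inv_cancel_left]
    rw [hWe]
    have hz0 : (z : ℂ) ≠ 0 := Circle.coe_ne_zero z
    have := (spectrum.smul_mem_smul_iff (r := Units.mk0 (z : ℂ) hz0)
      (a := (((expUnitary x)⁻¹ * W : unitary A) : A)) (s := (-1 : ℂ))).mpr hmem
    simpa [Units.smul_def] using this
  exact ⟨x, Unitary.argSelfAdjoint ((expUnitary x)⁻¹ * W), by
    rw [expUnitary_argSelfAdjoint hnorm, mul_inv_cancel_left]⟩

open selfAdjoint in
/-- A set of unitaries whose words of bounded length fill a neighbourhood of `1` generates the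
unitary group with a uniform word length. -/
lemma exists_pow_eq_univ_of_nhds [FiniteDimensional ℂ A] {S : Set (unitary A)}
    (h1 : (1 : unitary A) ∈ S) {L : ℕ}
    (h : ∀ᶠ W in 𝓝 (1 : unitary A), W ∈ S ^ L) : ∃ n : ℕ, S ^ n = Set.univ := by
  have := compactSpace_unitary (A := A)
  -- `exp (i x)` is a power of `exp (i x / m)`, which is close to `1` for large `m`.
  have hexp : ∀ x : selfAdjoint A, ∃ n : ℕ, expUnitary x ∈ S ^ n := by
    intro x
    have hpow : ∀ (y : selfAdjoint A) (m : ℕ), expUnitary (m • y) = expUnitary y ^ m := by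
      intro y m
      induction m with
      | zero => simp
      | succ m ih =>
        rw [succ_nsmul, Commute.expUnitary_add, ih, pow_succ]
        exact ((Commute.refl (y : A)).smul_left m)
    have ht : Tendsto (fun m : ℕ => expUnitary ((1 / ((m : ℝ) + 1)) • x)) atTop (𝓝 1) := by
      have h2 := (tendsto_one_div_add_atTop_nhds_zero_nat (𝕜 := ℝ)).smul_const x
      rw [zero_smul] at h2
      have h3 := (continuous_expUnitary (A := A)).tendsto 0
      rw [expUnitary_zero] at h3
      exact h3.comp h2
    obtain ⟨m, hm⟩ := (ht.eventually h).exists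
    refine ⟨L * (m + 1), ?_⟩
    have : expUnitary x = expUnitary ((1 / ((m : ℝ) + 1)) • x) ^ (m + 1) := by
      rw [← hpow, ← Nat.cast_smul_eq_nsmul ℝ, smul_smul]
      congr 1
      push_cast
      rw [mul_one_div_cancel (by positivity), one_smul]
    rw [this, pow_mul]
    exact Set.pow_mem_pow hm
  have hall : ∀ W : unitary A, ∃ n : ℕ, W ∈ S ^ n := by
    intro W
    obtain ⟨x, y, rfl⟩ := exists_eq_expUnitary_mul W
    obtain ⟨n, hn⟩ := hexp x
    obtain ⟨m, hm⟩ := hexp y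
    exact ⟨n + m, by rw [pow_add]; exact Set.mul_mem_mul hn hm⟩
  have hmono : Monotone fun n : ℕ => interior (S ^ n) := fun m n hmn =>
    interior_mono (Set.pow_subset_pow_right h1 hmn)
  obtain ⟨n, hn⟩ := isCompact_univ.elim_directed_cover (fun n : ℕ => interior (S ^ n))
    (fun n => isOpen_interior) (fun W _ => by
      obtain ⟨n, hn⟩ := hall W
      refine Set.mem_iUnion.mpr ⟨n + L, mem_interior_iff_mem_nhds.mpr ?_⟩
      have hc : Tendsto (fun U : unitary A => W⁻¹ * U) (𝓝 W) (𝓝 1) := by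
        have : Continuous (fun U : unitary A => W⁻¹ * U) := by fun_prop
        simpa using this.tendsto W
      filter_upwards [hc.eventually h] with U hU
      rw [pow_add]
      exact Set.mem_mul.mpr ⟨W, hn, _, hU, mul_inv_cancel_left _ _⟩)
    (hmono.directed_le)
  exact ⟨n, Set.univ_subset_iff.mp (hn.trans interior_subset)⟩

end UnitaryWords

end BipartiteGates

namespace BipartiteGates

open Matrix

open scoped Matrix.Norms.L2Operator

/-! ### Universality of imprimitive gates -/

lemma exp_kronecker_one {dA dB : ℕ} (X : Matrix (Fin dA) (Fin dA) ℂ) :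
    NormedSpace.exp (X ⊗ₖ (1 : Matrix (Fin dB) (Fin dB) ℂ)) = NormedSpace.exp X ⊗ₖ 1 := by
  let f : Matrix (Fin dA) (Fin dA) ℂ →+* Matrix (Fin dA × Fin dB) (Fin dA × Fin dB) ℂ :=
    { toFun := fun X => X ⊗ₖ 1
      map_one' := one_kronecker_one
      map_mul' := fun X Y => by rw [← mul_kronecker_mul, Matrix.one_mul]
      map_zero' := zero_kronecker _
      map_add' := fun X Y => add_kronecker _ _ _ }
  have hf : Continuous f := continuous_matrix fun p q => by
    change Continuous fun X : Matrix (Fin dA) (Fin dA) ℂ =>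
      X p.1 q.1 * (1 : Matrix (Fin dB) (Fin dB) ℂ) p.2 q.2
    fun_prop
  let +nondep : NormedAlgebra ℚ (Matrix (Fin dA) (Fin dA) ℂ) := .restrictScalars ℚ ℂ _
  exact (NormedSpace.map_exp f hf X).symm

lemma exp_one_kronecker {dA dB : ℕ} (Y : Matrix (Fin dB) (Fin dB) ℂ) :
    NormedSpace.exp ((1 : Matrix (Fin dA) (Fin dA) ℂ) ⊗ₖ Y) = 1 ⊗ₖ NormedSpace.exp Y := by
  let f : Matrix (Fin dB) (Fin dB) ℂ →+* Matrix (Fin dA × Fin dB) (Fin dA × Fin dB) ℂ :=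
    { toFun := fun Y => 1 ⊗ₖ Y
      map_one' := one_kronecker_one
      map_mul' := fun X Y => by rw [← mul_kronecker_mul, Matrix.one_mul]
      map_zero' := kronecker_zero _
      map_add' := fun X Y => kronecker_add _ _ _ }
  have hf : Continuous f := continuous_matrix fun p q => by
    change Continuous fun Y : Matrix (Fin dB) (Fin dB) ℂ =>
      (1 : Matrix (Fin dA) (Fin dA) ℂ) p.1 q.1 * Y p.2 q.2
    fun_prop
  let +nondep : NormedAlgebra ℚ (Matrix (Fin dB) (Fin dB) ℂ) := .restrictScalars ℚ ℂ _
  exact (NormedSpace.map_exp f hf Y).symm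

/-- The complex subspace of all `T` whose skew-adjoint parts `T - T⋆` and `I (T + T⋆)` lie in the
real subspace `D`; for `D` consisting of skew-adjoint operators it is `D + I D`. -/
def complexification {ι : Type*} (D : Submodule ℝ (Matrix ι ι ℂ)) :
    Submodule ℂ (Matrix ι ι ℂ) where
  carrier := {T | T - Tᴴ ∈ D ∧ Complex.I • (T + Tᴴ) ∈ D}
  zero_mem' := by simp
  add_mem' := by
    rintro T T' ⟨h1, h2⟩ ⟨h1', h2'⟩
    constructor
    · convert D.add_mem h1 h1' using 1
      rw [conjTranspose_add]
      abel
    · convert D.add_mem h2 h2' using 1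
      rw [conjTranspose_add, ← smul_add]
      congr 1
      abel
  smul_mem' := by
    rintro z T ⟨h1, h2⟩
    constructor
    · convert D.add_mem (D.smul_mem z.re h1) (D.smul_mem z.im h2) using 1
      ext p q
      apply Complex.ext <;> simp <;> ring
    · convert D.sub_mem (D.smul_mem z.re h2) (D.smul_mem z.im h1) using 1
      ext p q
      apply Complex.ext <;> simp <;> ring

lemma mem_complexification {ι : Type*} {D : Submodule ℝ (Matrix ι ι ℂ)} {T : Matrix ι ι ℂ} :
    T ∈ complexification D ↔ T - Tᴴ ∈ D ∧ Complex.I • (T + Tᴴ) ∈ D := Iff.rfl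

lemma one_mem_gateSet {dA dB : ℕ} (V : BipartiteUnitary dA dB) : 1 ∈ gateSet V :=
  Or.inl ⟨1, 1, by simp⟩

lemma exp_mem_unitaryGroup_of_isHermitian {n : Type*} [Fintype n] [DecidableEq n] {H : Matrix n n ℂ}
    (hH : H.IsHermitian) (t : ℝ) :
    NormedSpace.exp (Complex.I • (t • H)) ∈ Matrix.unitaryGroup n ℂ :=
  (selfAdjoint.expUnitary (t • (⟨H, hH⟩ : selfAdjoint (Matrix n n ℂ)))).2

/-- An imprimitive gate together with the local unitaries generates the unitary group with a uniform
word length. -/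
lemma exists_gateSet_pow_eq_univ {dA dB : ℕ} (V : BipartiteUnitary dA dB) (hV : IsImprimitive V) :
    ∃ L : ℕ, gateSet V ^ L = Set.univ := by
  obtain ⟨D, P, hDP, hexp, hconj⟩ := exists_isReachable_maximal (gateSet V) (one_mem_gateSet V)
  have hA : ∀ H : Matrix (Fin dA) (Fin dA) ℂ, H.IsHermitian →
      Complex.I • (H ⊗ₖ (1 : Matrix (Fin dB) (Fin dB) ℂ)) ∈ D := by
    intro H hH
    refine hexp ⟨H ⊗ₖ 1, ?_⟩ fun t => Or.inl
      ⟨⟨_, exp_mem_unitaryGroup_of_isHermitian hH t⟩, 1, ?_⟩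
    · change (H ⊗ₖ (1 : Matrix (Fin dB) (Fin dB) ℂ))ᴴ = _
      rw [conjTranspose_kronecker, hH.eq, conjTranspose_one]
    · change NormedSpace.exp (Complex.I • (t • (H ⊗ₖ (1 : Matrix (Fin dB) (Fin dB) ℂ)))) = _
      rw [← smul_kronecker, ← smul_kronecker, exp_kronecker_one]
      rfl
  have hB : ∀ H : Matrix (Fin dB) (Fin dB) ℂ, H.IsHermitian →
      Complex.I • ((1 : Matrix (Fin dA) (Fin dA) ℂ) ⊗ₖ H) ∈ D := by
    intro H hH
    refine hexp ⟨1 ⊗ₖ H, ?_⟩ fun t => Or.inl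
      ⟨1, ⟨_, exp_mem_unitaryGroup_of_isHermitian hH t⟩, ?_⟩
    · change ((1 : Matrix (Fin dA) (Fin dA) ℂ) ⊗ₖ H)ᴴ = _
      rw [conjTranspose_kronecker, hH.eq, conjTranspose_one]
    · change NormedSpace.exp (Complex.I • (t • ((1 : Matrix (Fin dA) (Fin dA) ℂ) ⊗ₖ H))) = _
      rw [← kronecker_smul, ← kronecker_smul, exp_one_kronecker]
      rfl
  set M := complexification D with hM
  have hskew : ∀ {n : Type} (X : Matrix n n ℂ), ((-Complex.I) • (X - Xᴴ)).IsHermitian := by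
    intro n X
    rw [IsHermitian, conjTranspose_smul, conjTranspose_sub, conjTranspose_conjTranspose]
    ext
    simp
    ring
  have hle : localOperators dA dB ≤ M := by
    rintro _ ⟨X, Y, rfl⟩
    rw [hM, mem_complexification, conjTranspose_add, conjTranspose_kronecker,
      conjTranspose_kronecker, conjTranspose_one, conjTranspose_one]
    constructor
    · convert D.add_mem (hA _ (hskew X)) (hB _ (hskew Y)) using 1
      rw [smul_kronecker, kronecker_smul, smul_smul, smul_smul, mul_neg, Complex.I_mul_I, neg_neg,
        one_smul, one_smul, sub_eq_add_neg X, sub_eq_add_neg Y, ← neg_one_smul ℂ Xᴴ,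
        ← neg_one_smul ℂ Yᴴ, add_kronecker, kronecker_add, smul_kronecker, kronecker_smul,
        neg_one_smul, neg_one_smul]
      abel
    · convert D.add_mem (hA _ (isHermitian_add_transpose_self X))
        (hB _ (isHermitian_add_transpose_self Y)) using 1
      rw [← smul_add, add_kronecker, kronecker_add]
      congr 1
      abel
  have hMconj : ∀ U ∈ gateSet V, ∀ T ∈ M, U.1 * T * U.1ᴴ ∈ M := by
    rintro U hU T ⟨h1, h2⟩
    have hstar : (U.1 * T * U.1ᴴ)ᴴ = U.1 * Tᴴ * U.1ᴴ := by
      simp [conjTranspose_mul, Matrix.mul_assoc]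
    constructor
    · convert hconj U hU _ h1 using 1
      rw [hstar, star_eq_conjTranspose, Matrix.mul_sub, Matrix.sub_mul]
    · convert hconj U hU _ h2 using 1
      rw [hstar, star_eq_conjTranspose, Matrix.mul_smul, Matrix.smul_mul, Matrix.mul_add,
        Matrix.add_mul]
  -- If `M` consisted of the local operators only, `V` would normalize them.
  have htop : M = ⊤ := by
    refine eq_top_of_localOperators_lt M (fun U hU W hW T hT => ?_) (lt_of_le_of_ne hle ?_)
    · exact hMconj ⟨U ⊗ₖ W, kronecker_mem_unitary hU hW⟩ (Or.inl ⟨⟨U, hU⟩, ⟨W, hW⟩, rfl⟩) T hT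
    · intro heq
      refine not_isImprimitive_of_normalizes V (fun T hT => ?_) hV
      rw [heq] at hT ⊢
      exact hMconj V (Or.inr rfl) T hT
  have hD : ∀ d : Matrix (Fin dA × Fin dB) (Fin dA × Fin dB) ℂ, star d = -d → d ∈ D := by
    intro d hd
    have hdM : d ∈ M := htop ▸ Submodule.mem_top
    have h2 := D.smul_mem (1 / 2 : ℝ) (mem_complexification.mp hdM).1
    rw [star_eq_conjTranspose] at hd
    rw [hd, sub_neg_eq_add, ← two_smul ℝ d, smul_smul] at h2
    norm_num at h2
    exact h2
  obtain ⟨L, hL⟩ := hDP.exists_nhds_subset hD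
  obtain ⟨L', hL'⟩ := exists_nhds_one_subset hL
  exact exists_pow_eq_univ_of_nhds (one_mem_gateSet V) hL'

/-- A uniform word length gives exact universality; the identity gate, which is local, replaces the
empty word. -/
lemma isExactlyUniversal_of_pow_eq_univ {G : Type*} [Group G] {S : Set G} (h1 : (1 : G) ∈ S)
    {L : ℕ} (hL : S ^ L = Set.univ) : IsExactlyUniversal S := by
  intro W
  have hpow : ∀ (n : ℕ) (U : G), U ∈ S ^ n → ∃ l : List G, (∀ x ∈ l, x ∈ S) ∧ U = l.prod := by
    intro n
    induction n with
    | zero =>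
      intro U hU
      exact ⟨[], by simp, by simpa using hU⟩
    | succ n ih =>
      intro U hU
      rw [pow_succ] at hU
      obtain ⟨a, ha, b, hb, rfl⟩ := Set.mem_mul.mp hU
      obtain ⟨l, hl, rfl⟩ := ih a ha
      refine ⟨l ++ [b], ?_, by simp⟩
      intro x hx
      rcases List.mem_append.mp hx with hx | hx
      · exact hl x hx
      · rwa [List.mem_singleton.mp hx]
  obtain ⟨l, hl, rfl⟩ := hpow L W (hL ▸ Set.mem_univ W)
  exact ⟨1 :: l, by simp, by simpa using ⟨h1, hl⟩, by simp⟩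

end BipartiteGates

theorem mainTheorem2 (dA dB : ℕ) (V : BipartiteGates.BipartiteUnitary dA dB) :
    (BipartiteGates.IsImprimitive V ↔
      V ∉ BipartiteGates.localUnitaries dA dB ∧
        V ∉ BipartiteGates.swapLocalUnitaries dA dB) ∧
    (BipartiteGates.IsImprimitive V →
      BipartiteGates.IsExactlyUniversal (BipartiteGates.gateSet V) ∧
        ∃ L : ℕ, (BipartiteGates.gateSet V) ^ L =
          (Set.univ : Set (BipartiteGates.BipartiteUnitary dA dB))) := by
  refine ⟨BipartiteGates.isImprimitive_iff V, fun hV => ?_⟩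
  obtain ⟨L, hL⟩ := BipartiteGates.exists_gateSet_pow_eq_univ V hV
  exact ⟨BipartiteGates.isExactlyUniversal_of_pow_eq_univ (BipartiteGates.one_mem_gateSet V) hL,
    L, hL⟩
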